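/- Let $(\Omega,\mathcal F,(\mathcal F_t)_{t\ge 0},P)$ be a filtered probability space satisfying the usual conditions, and let $Z$ be a real semimartingale on it, with jumps $\Delta Z_s=Z_s-Z_{s-}$ (and $Z_{0-}=Z_0$). Let $(T_n)_{n\ge1}$ be a sequence of stopping times with values in $[0,\infty]$ and pairwise disjoint graphs such that almost surely every jump time of $Z$ is one of the finite $T_n$. Let $(W,H,\mu)$ be an abstract Wiener space: $W$ is a separable Fréchet space, the Hilbert space $H$ is continuously, injectively and densely embedded in $W$, and $\mu$ is the Borel probability measure on $W$ under which every $l\in W^\star$ is a centred Gaussian variable with variance $|l|_H|^2_{H^\star}$. Let $(e_n)_{n\ge1}$ be an orthonormal basis of $H$ consisting of (images in $H$ of) elements of $W^\star$: for each $n$ there is a (unique) $\delta e_n\in W^\star$ with $\delta e_n(h)=\langle e_n,h\rangle_H$ for all $h\in H$; it is the Gaussian divergence of $e_n$. Fix $t\ge 0$ and put $$u_t(w,z)=\sum_{n:\,T_n(z)\le t}\Delta Z_{T_n}(z)\,\delta e_n(w)\,e_n,\qquad U_t(w,z)=w+u_t(w,z),\qquad (w,z)\in W\times\Omega .$$ 1.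 For $\mu\times P$-almost every $(w,z)$ the series converges (unconditionally) in $H$. The resulting maps $u_t$, with values in $H$, and $U_t$, with values in $W$, are $\mu\times P$-measurable. Thus $U_t$ is a $\mu\times P$-almost surely well-defined perturbation of the identity on $W$. 2. For $P$-almost every $z$ the map $w\mapsto u_t(w,z)$ is $H$-$C^1$, and even $H$-$C^\infty$, with constant derivative: there is a set $N_z\subset W$ with $\mu(N_z)=0$ which is $H$-invariant ($N_z+H\subset N_z$) and has zero $(p,k)$-capacity for all the Gaussian Sobolev spaces $\mathbb D_{p,k}$, $p>1$, $k\in\mathbb N$, such that for every $w\notin N_z$ the series defining $u_t(w+h,z)$ converges in $H$ for all $h\in H$, and $h\mapsto u_t(w+h,z)$ is a $C^1$, and even a $C^\infty$, map from $H$ to $H$, whose derivative at every $h$ is the Hilbert–Schmidt operator $\nabla u_t(z)=\sum_{n:\,T_n(z)\le t}\Delta Z_{T_n}(z)\,e_n\otimes e_n$, independent of $w$ and $h$. -/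

import Mathlib

open MeasureTheory ProbabilityTheory Filter Topology
open scoped NNReal ENNReal ContDiff

noncomputable section

/-! ### Semimartingales in continuous time -/

/-- A path is càdlàg: right-continuous, with a (finite) left limit at every time. -/
def IsCadlagPath (f : ℝ≥0 → ℝ) : Prop :=
  ∀ s, ContinuousWithinAt f (Set.Ioi s) s ∧ ∃ y, Tendsto f (𝓝[<] s) (𝓝 y)

/-- The usual conditions: the filtration is right-continuous and `𝓕 0` contains every `P`-null set
(`P` is applied to arbitrary sets as an outer measure, so this contains the completeness of
the probability space). -/
structure UsualConditions {Ω : Type*} {mΩ : MeasurableSpace Ω} (𝓕 : Filtration ℝ≥0 mΩ)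
    (P : Measure Ω) : Prop where
  rightContinuous : 𝓕.IsRightContinuous
  complete : ∀ s : Set Ω, P s = 0 → MeasurableSet[𝓕 0] s

/-- A càdlàg local martingale: an adapted process with almost surely càdlàg paths such that, for
some stopping times `τ n` increasing to infinity, each process `t ↦ 1_{τ n > 0} M_{t ∧ τ n}` is a
martingale. -/
structure IsCadlagLocalMartingale {Ω : Type*} {mΩ : MeasurableSpace Ω} (𝓕 : Filtration ℝ≥0 mΩ)
    (P : Measure Ω) (M : ℝ≥0 → Ω → ℝ) : Prop where
  adapted : StronglyAdapted 𝓕 M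
  cadlag : ∀ᵐ z ∂P, IsCadlagPath (fun s => M s z)
  localMartingale : Locally (fun Y => Martingale Y 𝓕 P) 𝓕 M P

/-- An adapted process with almost surely càdlàg paths of bounded variation on every compact
interval. -/
structure IsFiniteVariationProcess {Ω : Type*} {mΩ : MeasurableSpace Ω} (𝓕 : Filtration ℝ≥0 mΩ)
    (P : Measure Ω) (A : ℝ≥0 → Ω → ℝ) : Prop where
  adapted : StronglyAdapted 𝓕 A
  cadlag : ∀ᵐ z ∂P, IsCadlagPath (fun s => A s z)
  variation : ∀ᵐ z ∂P, LocallyBoundedVariationOn (fun s => A s z) Set.univ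

/-- A real semimartingale: an adapted process that is, up to indistinguishability, the sum of a
càdlàg local martingale and a càdlàg adapted process of locally bounded variation (the initial
value is absorbed in either of them). -/
structure IsSemimartingale {Ω : Type*} {mΩ : MeasurableSpace Ω} (𝓕 : Filtration ℝ≥0 mΩ)
    (P : Measure Ω) (Z : ℝ≥0 → Ω → ℝ) : Prop where
  adapted : StronglyAdapted 𝓕 Z
  decomposition : ∃ M A : ℝ≥0 → Ω → ℝ, IsCadlagLocalMartingale 𝓕 P M ∧
    IsFiniteVariationProcess 𝓕 P A ∧ ∀ᵐ z ∂P, ∀ s, Z s z = M s z + A s z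

/-- The jump `ΔZ_s = Z_s - Z_{s-}`, with `Z_{0-} = Z_0`. -/
def jump {Ω : Type*} (Z : ℝ≥0 → Ω → ℝ) (s : ℝ≥0) (z : Ω) : ℝ :=
  Z s z - Function.leftLim (fun r => Z r z) s

/-- `T` is a sequence of stopping times with (almost surely) pairwise disjoint graphs which absorbs
the jumps of `Z`: almost surely every jump time of `Z` is one of the finite `T n`. -/
structure AbsorbsJumps {Ω : Type*} {mΩ : MeasurableSpace Ω} (𝓕 : Filtration ℝ≥0 mΩ)
    (P : Measure Ω) (Z : ℝ≥0 → Ω → ℝ) (T : ℕ → Ω → WithTop ℝ≥0) : Prop where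
  stopping : ∀ n, IsStoppingTime 𝓕 (T n)
  disjoint : ∀ᵐ z ∂P, ∀ m n, m ≠ n → T m z = T n z → T m z = ⊤
  absorb : ∀ᵐ z ∂P, ∀ s : ℝ≥0, jump Z s z ≠ 0 → ∃ n, T n z = (s : WithTop ℝ≥0)

/-- The coefficient `1_{T_n(z) ≤ t} ΔZ_{T_n}(z)`. -/
def jumpCoeff {Ω : Type*} (Z : ℝ≥0 → Ω → ℝ) (T : ℕ → Ω → WithTop ℝ≥0) (t : ℝ≥0) (n : ℕ)
    (z : Ω) : ℝ :=
  if T n z ≤ (t : WithTop ℝ≥0) then jump Z (T n z).untopA z else 0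

/-! ### Abstract Wiener spaces -/

section Wiener

variable {W H : Type*} [AddCommGroup W] [Module ℝ W] [TopologicalSpace W] [MeasurableSpace W]
  [NormedAddCommGroup H] [InnerProductSpace ℝ H]

/-- `(W, H, μ)` is an abstract Wiener space: `i : H → W` is a continuous, injective linear map
with dense range, and every continuous linear functional `l` on `W` is, under `μ`, a centred
Gaussian variable whose variance is the square of the norm of `l ∘ i` in the dual of `H`. -/
structure IsAbstractWienerSpace (i : H →L[ℝ] W) (μ : Measure W) : Prop where
  injective : Function.Injective i
  dense : DenseRange i
  gaussian : ∀ l : StrongDual ℝ W, μ.map l = gaussianReal 0 (‖l.comp i‖₊ ^ 2)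

/-- The image of `l` under the embedding of `W*` into `H` (the adjoint of `i`) is `h`. For such an
`h`, the Gaussian divergence (Wiener integral) `δh` is the function `w ↦ l w`, which is defined
everywhere on `W`. -/
def IsDivergence (i : H →L[ℝ] W) (l : StrongDual ℝ W) (h : H) : Prop :=
  ∀ k : H, l (i k) = inner ℝ h k

/-- `N + H ⊆ N`. Since `H` is a vector space, this is invariance under translations by `H`. -/
def IsHInvariant (i : H →L[ℝ] W) (N : Set W) : Prop :=
  ∀ w ∈ N, ∀ h : H, w + i h ∈ N

/-! ### Gaussian Sobolev spaces and capacities -/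

/-- Smooth cylindrical functions `F(w) = f(l₁(w), …, l_m(w))`, where `f` is smooth and has, together
with its derivatives, at most polynomial growth. -/
def IsSmoothCylindrical (F : W → ℝ) : Prop :=
  ∃ (m : ℕ) (l : Fin m → StrongDual ℝ W) (f : (Fin m → ℝ) → ℝ),
    Function.HasTemperateGrowth f ∧ ∀ w, F w = f (fun a => l a w)

/-- The `r`-th derivative `∇^r F(w)` in the directions of `H`. -/
def hDeriv (i : H →L[ℝ] W) (r : ℕ) (F : W → ℝ) (w : W) : H [×r]→L[ℝ] ℝ :=
  iteratedFDeriv ℝ r (fun h : H => F (w + i h)) 0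

/-- The Hilbert–Schmidt norm of an `r`-linear form on `H`; it does not depend on the orthonormal
basis `b` in which it is computed. -/
def hsNorm (b : HilbertBasis ℕ ℝ H) {r : ℕ} (A : H [×r]→L[ℝ] ℝ) : ℝ≥0∞ :=
  (∑' a : Fin r → ℕ, ‖A (fun q => b (a q))‖ₑ ^ 2) ^ (1 / 2 : ℝ)

/-- The Sobolev norm `‖F‖_{p,k} = ∑_{r ≤ k} ‖∇^r F‖_{L^p(μ; H^{⊗ r})}` of a smooth cylindrical
function. -/
def cylSobolevNorm (i : H →L[ℝ] W) (μ : Measure W) (b : HilbertBasis ℕ ℝ H) (p : ℝ) (k : ℕ)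
    (F : W → ℝ) : ℝ≥0∞ :=
  ∑ r ∈ Finset.range (k + 1), (∫⁻ w, hsNorm b (hDeriv i r F w) ^ p ∂μ) ^ (1 / p)

/-- `G` belongs to the Sobolev space `𝔻_{p,k}`, the completion of the smooth cylindrical functions,
and `‖G‖_{p,k} = c`. -/
def HasSobolevNorm (i : H →L[ℝ] W) (μ : Measure W) (b : HilbertBasis ℕ ℝ H) (p : ℝ) (k : ℕ)
    (G : W → ℝ) (c : ℝ≥0∞) : Prop :=
  AEStronglyMeasurable G μ ∧ ∃ F : ℕ → W → ℝ, (∀ n, IsSmoothCylindrical (F n)) ∧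
    Tendsto (fun n => eLpNorm (F n - G) (ENNReal.ofReal p) μ) atTop (𝓝 0) ∧
    (∀ ε : ℝ≥0∞, 0 < ε → ∃ n₀, ∀ m ≥ n₀, ∀ n ≥ n₀, cylSobolevNorm i μ b p k (F m - F n) ≤ ε) ∧
    Tendsto (fun n => cylSobolevNorm i μ b p k (F n)) atTop (𝓝 c)

/-- The `(p,k)`-capacity of an open set `O`: the infimum of `‖G‖_{p,k}^p` over the
`G ∈ 𝔻_{p,k}` with `G ≥ 1` almost everywhere on `O`. -/
def openCapacity (i : H →L[ℝ] W) (μ : Measure W) (b : HilbertBasis ℕ ℝ H) (p : ℝ) (k : ℕ)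
    (O : Set W) : ℝ≥0∞ :=
  ⨅ (G : W → ℝ) (c : ℝ≥0∞) (_ : HasSobolevNorm i μ b p k G c)
    (_ : ∀ᵐ w ∂μ, w ∈ O → 1 ≤ G w), c ^ p

/-- The `(p,k)`-capacity of an arbitrary set. -/
def gaussianCapacity (i : H →L[ℝ] W) (μ : Measure W) (b : HilbertBasis ℕ ℝ H) (p : ℝ) (k : ℕ)
    (N : Set W) : ℝ≥0∞ :=
  ⨅ (O : Set W) (_ : IsOpen O) (_ : N ⊆ O), openCapacity i μ b p k O

/-- `N` has capacity zero, for all the capacities `C_{p,k}`, `p > 1`, `k ∈ ℕ`. -/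
def HasZeroCapacity (i : H →L[ℝ] W) (μ : Measure W) (b : HilbertBasis ℕ ℝ H) (N : Set W) : Prop :=
  ∀ p : ℝ, 1 < p → ∀ k : ℕ, gaussianCapacity i μ b p k N = 0

/-! ### The perturbation of identity -/

/-- The `n`-th term `1_{T_n(z) ≤ t} ΔZ_{T_n}(z) δe_n(w) e_n`, where `δe_n = l n`. -/
def shiftTerm {Ω : Type*} (Z : ℝ≥0 → Ω → ℝ) (T : ℕ → Ω → WithTop ℝ≥0) (e : HilbertBasis ℕ ℝ H)
    (l : ℕ → StrongDual ℝ W) (t : ℝ≥0) (w : W) (z : Ω) (n : ℕ) : H :=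
  (jumpCoeff Z T t n z * l n w) • e n

/-- `u_t(w,z) = ∑_{T_n(z) ≤ t} ΔZ_{T_n}(z) δe_n(w) e_n`, the series being taken in `H`. -/
def shift {Ω : Type*} (Z : ℝ≥0 → Ω → ℝ) (T : ℕ → Ω → WithTop ℝ≥0) (e : HilbertBasis ℕ ℝ H)
    (l : ℕ → StrongDual ℝ W) (t : ℝ≥0) (w : W) (z : Ω) : H :=
  ∑' n, shiftTerm Z T e l t w z n

/-- `U_t(w,z) = w + u_t(w,z)`, with `H` embedded in `W` by `i`. -/
def perturbedId {Ω : Type*} (i : H →L[ℝ] W) (Z : ℝ≥0 → Ω → ℝ) (T : ℕ → Ω → WithTop ℝ≥0)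
    (e : HilbertBasis ℕ ℝ H) (l : ℕ → StrongDual ℝ W) (t : ℝ≥0) (w : W) (z : Ω) : W :=
  w + i (shift Z T e l t w z)

end Wiener

end

/-! Write `a n` for `jumpCoeff Z T t n z`. Since `e` is orthonormal, the series converges in `H`
exactly when `∑ a n ^ 2 * l n w ^ 2` is finite. Under `μ` each `l n` is standard Gaussian, so for
fixed `z` this sum has expectation `∑ a n ^ 2`, and everything rests on the square summability of
the jumps (`IsSemimartingale.summable_sq_jumpCoeff`).

That fact is obtained without stochastic integration. For a discrete martingale, a weak-type bound
controls the expected sum of squared increments on the event that the path stays in `[-L, L]`, by a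
constant that depends only on `L` and the `L¹` norm of the last variable
(`integral_square_function_le`). On uniform grids of `[0, t]` this bound is uniform in the mesh, and
Fatou's lemma gives paths whose grid sums are bounded along a subsequence. Localisation covers local
martingales, and finite variation paths are direct. Distinct jump times end up in distinct grid
intervals, so a subsequential bound on the grid sums bounds the sum of squared jumps
(`IsCadlagPath.sum_sq_jump_le`).

For the behaviour along `H`, translation by `h` adds `∑ a n ⟪e n, h⟫ e n`, which always converges.
Hence the domain of convergence is `H`-invariant, and there the map is affine along `H` with linear
part the diagonal operator `D`, so its smoothness is automatic. The exceptional set is where the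
quadratic form `∑ a n ^ 2 * l n w ^ 2` is infinite. This form lies in every Sobolev space, and a
Chebyshev argument with the form multiplied by a small `ρ` shows that the set has zero capacity
(`hasZeroCapacity_not_summable`). Joint almost sure convergence follows by Fubini. -/

set_option linter.unusedSectionVars false

/-! ### Square functions of martingales and jumps of semimartingales -/

section DiscreteSquareFunction

variable {Ω : Type*} {mΩ : MeasurableSpace Ω} {P : Measure Ω}

/-- A bounded `m`-measurable factor is orthogonal to a martingale increment. -/
lemma integral_bdd_mul_eq_of_condExp {m : MeasurableSpace Ω} (hm : m ≤ mΩ) [IsFiniteMeasure P]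
    {x y φ : Ω → ℝ} (hy : Integrable y P) (hxy : P[y|m] =ᵐ[P] x)
    (hφ : StronglyMeasurable[m] φ) {c : ℝ} (hc : ∀ z, ‖φ z‖ ≤ c) :
    ∫ z, φ z * y z ∂P = ∫ z, φ z * x z ∂P := by
  have h := condExp_stronglyMeasurable_mul_of_bound hm hφ hy c (ae_of_all _ hc)
  calc ∫ z, φ z * y z ∂P = ∫ z, (P[φ * y|m]) z ∂P := (integral_condExp hm).symm
    _ = ∫ z, φ z * x z ∂P := by
      refine integral_congr_ae ?_
      filter_upwards [h, hxy] with z h1 h2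
      rw [h1, Pi.mul_apply, h2]

/-- The event that the process stays in `[-L, L]` up to time `k`. -/
def stayBounded (X : ℕ → Ω → ℝ) (L : ℝ) (k : ℕ) : Set Ω := {z | ∀ j ≤ k, |X j z| ≤ L}

lemma stayBounded_antitone (X : ℕ → Ω → ℝ) (L : ℝ) : Antitone (stayBounded X L) :=
  fun _ _ h _ hz j hj => hz j (hj.trans h)

lemma measurableSet_stayBounded {ℱ : Filtration ℕ mΩ} {X : ℕ → Ω → ℝ} (hX : StronglyAdapted ℱ X)
    (L : ℝ) (k : ℕ) : MeasurableSet[ℱ k] (stayBounded X L k) := by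
  have : stayBounded X L k = ⋂ j, ⋂ (_ : j ≤ k), {z | |X j z| ≤ L} := by
    ext; simp [stayBounded]
  rw [this]
  refine MeasurableSet.iInter fun j => MeasurableSet.iInter fun hj => ?_
  have h : Measurable[ℱ k] (X j) := ((hX j).mono (ℱ.mono hj)).measurable
  convert! h (measurableSet_Icc : MeasurableSet (Set.Icc (-L) L)) using 1
  ext z
  simp [abs_le]

/-- The Lyapunov function is `x ^ 2` before leaving `[-L, L]` and `2 * L * |x|` afterwards. Before
exit the inequality is the expansion of the square, at exit it is `x * y ≤ L * |y|`, and after exit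
it is convexity of `|·|`. The slope multiplying `y - x` depends on the past only, so that term
vanishes in expectation for a martingale. -/
lemma square_increment_le {x y L : ℝ} (p q : Prop) [Decidable p] [Decidable q]
    (hqp : q → p) (hp : p → |x| ≤ L) (hL : 0 ≤ L) :
    (if q then (y - x) ^ 2 else 0) ≤
      ((if q then y ^ 2 else 2 * L * |y|) - (if p then x ^ 2 else 2 * L * |x|)) -
        (if p then 2 * x else 2 * L * SignType.sign x) * (y - x) := by
  by_cases h : p
  · by_cases h' : q
    · simp only [h, h', if_true]; nlinarith
    · simp only [h, h', if_true, if_false]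
      have h1 : x * y ≤ L * |y| := by
        calc x * y ≤ |x * y| := le_abs_self _
          _ = |x| * |y| := abs_mul _ _
          _ ≤ L * |y| := by gcongr; exact hp h
      nlinarith [sq_nonneg x]
  · have h' : ¬ q := fun hq => h (hqp hq)
    simp only [h, h', if_false]
    have h1 : (SignType.sign x : ℝ) * x = |x| := sign_mul_self x
    have h2 : (SignType.sign x : ℝ) * y ≤ |y| := by
      rcases lt_trichotomy x 0 with hx | hx | hx
      · simp [sign_neg hx, neg_le_abs]
      · simp [hx]
      · simp [sign_pos hx, le_abs_self]
    nlinarith [mul_le_mul_of_nonneg_left h2 hL]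

/-- A weak-type estimate for the square function of a martingale. -/
lemma integral_square_function_le [IsFiniteMeasure P] {ℱ : Filtration ℕ mΩ} {X : ℕ → Ω → ℝ}
    (hX : Martingale X ℱ P) {L : ℝ} (hL : 0 ≤ L) (n : ℕ) :
    ∫⁻ z, (stayBounded X L n).indicator
        (fun z => ENNReal.ofReal (∑ k ∈ Finset.range n, (X (k + 1) z - X k z) ^ 2)) z ∂P
      ≤ ENNReal.ofReal (2 * L * ∫ z, |X n z| ∂P) := by
  classical
  have hB : ∀ k, MeasurableSet (stayBounded X L k) := fun k =>
    ℱ.le k _ (measurableSet_stayBounded hX.1 L k)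
  have hXm : ∀ k, Measurable (X k) := fun k => ((hX.1 k).mono (ℱ.le k)).measurable
  -- The truncation at time `k + 1` bounds both endpoints of the increment, so `q k` is at most `(2
  -- * L) ^ 2`. `R` grows only linearly in `X k`. Thus an `L¹` martingale suffices.
  set q : ℕ → Ω → ℝ := fun k z =>
    if z ∈ stayBounded X L (k + 1) then (X (k + 1) z - X k z) ^ 2 else 0 with hq
  set R : ℕ → Ω → ℝ := fun k z =>
    if z ∈ stayBounded X L k then X k z ^ 2 else 2 * L * |X k z| with hR
  set φ : ℕ → Ω → ℝ := fun k z =>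
    if z ∈ stayBounded X L k then 2 * X k z else 2 * L * SignType.sign (X k z) with hφ
  have hRle : ∀ k z, R k z ≤ 2 * L * |X k z| := by
    intro k z
    by_cases h : z ∈ stayBounded X L k
    · simp only [hR, h, if_true]
      have := h k le_rfl
      rw [← sq_abs]
      nlinarith [abs_nonneg (X k z)]
    · simp only [hR, h, if_false]; exact le_rfl
  have hR0 : ∀ k z, 0 ≤ R k z := by
    intro k z
    simp only [hR]; split_ifs <;> positivity
  have hRm : ∀ k, Measurable (R k) := fun k =>
    Measurable.ite (hB k) ((hXm k).pow_const 2) ((hXm k).abs.const_mul _)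
  have hRi : ∀ k, Integrable (R k) P := fun k =>
    ((hX.integrable k).abs.const_mul (2 * L)).mono' (hRm k).aestronglyMeasurable
      (ae_of_all _ fun z => by rw [Real.norm_of_nonneg (hR0 k z)]; exact hRle k z)
  have hqm : ∀ k, Measurable (q k) := fun k =>
    Measurable.ite (hB (k + 1)) (((hXm (k + 1)).sub (hXm k)).pow_const 2) measurable_const
  have hq0 : ∀ k z, 0 ≤ q k z := by
    intro k z; simp only [hq]; split_ifs <;> positivity
  have hqi : ∀ k, Integrable (q k) P := fun k =>
    (integrable_const ((2 * L) ^ 2)).mono' (hqm k).aestronglyMeasurable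
      (ae_of_all _ fun z => by
        rw [Real.norm_of_nonneg (hq0 k z)]
        simp only [hq]
        split_ifs with h
        · have h1 := abs_le.1 (h (k + 1) le_rfl)
          have h2 := abs_le.1 (h k (Nat.le_succ k))
          apply sq_le_sq'  <;> linarith
        · positivity)
  have hφm : ∀ k, StronglyMeasurable[ℱ k] (φ k) := fun k => by
    have h1 : Measurable[ℱ k] (X k) := (hX.1 k).measurable
    have h2 : Measurable (fun x : ℝ => (SignType.sign x : ℝ)) := by
      have : (fun x : ℝ => (SignType.sign x : ℝ)) =
          fun x => if 0 < x then 1 else if x < 0 then -1 else 0 := by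
        ext x
        rcases lt_trichotomy x 0 with hx | hx | hx
        · simp [sign_neg hx, hx, hx.le]
        · simp [hx]
        · simp [sign_pos hx, hx]
      rw [this]
      exact Measurable.ite measurableSet_Ioi measurable_const
        (Measurable.ite measurableSet_Iio measurable_const measurable_const)
    exact (Measurable.ite (measurableSet_stayBounded hX.1 L k) (h1.const_mul 2)
      ((h2.comp h1).const_mul _)).stronglyMeasurable
  have hφb : ∀ k z, ‖φ k z‖ ≤ 2 * L := by
    intro k z
    simp only [hφ]
    split_ifs with h
    · rw [norm_mul, Real.norm_ofNat]
      exact mul_le_mul_of_nonneg_left (h k le_rfl) (by norm_num)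
    · rcases lt_trichotomy (X k z) 0 with hx | hx | hx
      · simp [sign_neg hx, abs_of_nonneg hL]
      · simp [hx, hL]
      · simp [sign_pos hx, abs_of_nonneg hL]
  have hstep : ∀ k, ∫ z, q k z ∂P ≤ ∫ z, R (k + 1) z ∂P - ∫ z, R k z ∂P := by
    intro k
    have hbdd : ∀ j, Integrable (fun z => φ k z * X j z) P := fun j =>
      (hX.integrable j).bdd_mul (c := 2 * L) ((hφm k).mono (ℱ.le k)).aestronglyMeasurable
        (ae_of_all _ (hφb k))
    have horth : ∫ z, φ k z * X (k + 1) z ∂P = ∫ z, φ k z * X k z ∂P :=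
      integral_bdd_mul_eq_of_condExp (ℱ.le k) (hX.integrable (k + 1))
        (hX.condExp_ae_eq (Nat.le_succ k)) (hφm k) (hφb k)
    calc ∫ z, q k z ∂P
        ≤ ∫ z, (R (k + 1) z - R k z) - (φ k z * X (k + 1) z - φ k z * X k z) ∂P := by
          refine integral_mono (hqi k)
            (((hRi (k + 1)).sub (hRi k)).sub ((hbdd (k + 1)).sub (hbdd k))) fun z => ?_
          have := square_increment_le (x := X k z) (y := X (k + 1) z) (L := L)
            (z ∈ stayBounded X L k) (z ∈ stayBounded X L (k + 1))
            (fun h => stayBounded_antitone X L (Nat.le_succ k) h) (fun h => h k le_rfl) hL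
          rw [mul_sub] at this
          exact this
      _ = _ := by
          refine (integral_sub ((hRi (k + 1)).sub (hRi k))
            ((hbdd (k + 1)).sub (hbdd k))).trans ?_
          rw [Pi.sub_def, Pi.sub_def, integral_sub (hRi (k + 1)) (hRi k),
            integral_sub (hbdd (k + 1)) (hbdd k), horth]
          ring
  have hsum : ∫ z, ∑ k ∈ Finset.range n, q k z ∂P ≤ 2 * L * ∫ z, |X n z| ∂P := by
    rw [integral_finsetSum _ fun k _ => hqi k]
    calc ∑ k ∈ Finset.range n, ∫ z, q k z ∂P
        ≤ ∑ k ∈ Finset.range n, (∫ z, R (k + 1) z ∂P - ∫ z, R k z ∂P) :=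
          -- The compensated increments telescope, leaving only the terminal value of `R`.
          Finset.sum_le_sum fun k _ => hstep k
      _ = ∫ z, R n z ∂P - ∫ z, R 0 z ∂P := Finset.sum_range_sub (fun k => ∫ z, R k z ∂P) n
      _ ≤ ∫ z, R n z ∂P := sub_le_self _ (integral_nonneg (hR0 0))
      _ ≤ ∫ z, 2 * L * |X n z| ∂P :=
          integral_mono (hRi n) ((hX.integrable n).abs.const_mul _) (hRle n)
      _ = _ := integral_const_mul _ _
  calc _ ≤ ∫⁻ z, ENNReal.ofReal (∑ k ∈ Finset.range n, q k z) ∂P := by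
        refine lintegral_mono fun z => ?_
        by_cases h : z ∈ stayBounded X L n
        · rw [Set.indicator_of_mem h]
          refine ENNReal.ofReal_le_ofReal (Finset.sum_le_sum fun k hk => ?_)
          simp only [hq]
          rw [if_pos (stayBounded_antitone X L (Finset.mem_range.1 hk) h)]
        · rw [Set.indicator_of_notMem h]; exact zero_le
    _ = ENNReal.ofReal (∫ z, ∑ k ∈ Finset.range n, q k z ∂P) :=
        (ofReal_integral_eq_lintegral_ofReal (integrable_finsetSum _ fun k _ => hqi k)
          (ae_of_all _ fun z => Finset.sum_nonneg fun k _ => hq0 k z)).symm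
    _ ≤ _ := ENNReal.ofReal_le_ofReal hsum

end DiscreteSquareFunction

/-! ### Uniform grids and sums of squared increments -/

section Grid

/-- The `k`-th point of the uniform grid with `n` intervals on `[0, t]`. -/
noncomputable def gridPoint (t : ℝ≥0) (n k : ℕ) : ℝ≥0 := t * k / n

lemma gridPoint_mono (t : ℝ≥0) (n : ℕ) : Monotone (gridPoint t n) := fun a b h => by
  unfold gridPoint; gcongr

lemma gridPoint_self (t : ℝ≥0) {n : ℕ} (hn : n ≠ 0) : gridPoint t n n = t := by
  unfold gridPoint; field_simp

lemma gridPoint_le (t : ℝ≥0) {n k : ℕ} (hk : k ≤ n) : gridPoint t n k ≤ t := by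
  rcases eq_or_ne n 0 with rfl | hn
  · simp [gridPoint]
  · exact (gridPoint_mono t n hk).trans_eq (gridPoint_self t hn)

/-- The sum of the squared increments of `f` along the uniform grid with `n` intervals. -/
noncomputable def gridSquareSum (f : ℝ≥0 → ℝ) (t : ℝ≥0) (n : ℕ) : ℝ :=
  ∑ k ∈ Finset.range n, (f (gridPoint t n (k + 1)) - f (gridPoint t n k)) ^ 2

lemma gridSquareSum_congr {f g : ℝ≥0 → ℝ} {t : ℝ≥0} (h : ∀ s ≤ t, f s = g s) (n : ℕ) :
    gridSquareSum f t n = gridSquareSum g t n := by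
  refine Finset.sum_congr rfl fun k hk => ?_
  have hk := Finset.mem_range.1 hk
  rw [h _ (gridPoint_le t hk), h _ (gridPoint_le t hk.le)]

lemma gridSquareSum_add_le (f g : ℝ≥0 → ℝ) (t : ℝ≥0) (n : ℕ) :
    gridSquareSum (fun s => f s + g s) t n ≤
      2 * gridSquareSum f t n + 2 * gridSquareSum g t n := by
  unfold gridSquareSum
  rw [Finset.mul_sum, Finset.mul_sum, ← Finset.sum_add_distrib]
  refine Finset.sum_le_sum fun k _ => ?_
  nlinarith [sq_nonneg ((f (gridPoint t n (k + 1)) - f (gridPoint t n k)) -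
    (g (gridPoint t n (k + 1)) - g (gridPoint t n k)))]

/-- A sum of squares of nonnegative numbers is at most the square of their sum, here the squared
total variation on `[0, t]`. -/
lemma exists_gridSquareSum_le_of_boundedVariation {f : ℝ≥0 → ℝ}
    (hf : LocallyBoundedVariationOn f Set.univ) (t : ℝ≥0) :
    ∃ C, ∀ n, gridSquareSum f t n ≤ C := by
  have hfin : eVariationOn f (Set.univ ∩ Set.Icc 0 t) ≠ ⊤ := hf 0 t trivial trivial
  refine ⟨(eVariationOn f (Set.univ ∩ Set.Icc 0 t)).toReal ^ 2, fun n => ?_⟩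
  have h1 : ∑ k ∈ Finset.range n, |f (gridPoint t n (k + 1)) - f (gridPoint t n k)| ≤
      (eVariationOn f (Set.univ ∩ Set.Icc 0 t)).toReal := by
    have := eVariationOn.sum_le_of_monotoneOn_Iic (f := f) (s := Set.univ ∩ Set.Icc 0 t) (n := n)
      (u := gridPoint t n) ((gridPoint_mono t n).monotoneOn _)
      (fun k hk => ⟨trivial, zero_le, gridPoint_le t hk⟩)
    rw [← ENNReal.toReal_le_toReal (by simp [edist_ne_top]) hfin,
      ENNReal.toReal_sum (by simp [edist_ne_top])] at this
    simpa [edist_dist, Real.dist_eq] using this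
  calc gridSquareSum f t n
      = ∑ k ∈ Finset.range n, |f (gridPoint t n (k + 1)) - f (gridPoint t n k)| ^ 2 := by
        simp [gridSquareSum, sq_abs]
    _ ≤ (∑ k ∈ Finset.range n, |f (gridPoint t n (k + 1)) - f (gridPoint t n k)|) ^ 2 :=
        Finset.sum_sq_le_sq_sum_of_nonneg fun _ _ => abs_nonneg _
    _ ≤ _ := by gcongr

/-- The index of the grid interval `(gridPoint k, gridPoint (k + 1)]` containing `s`. -/
noncomputable def gridIndex (t : ℝ≥0) (n : ℕ) (s : ℝ≥0) : ℕ := ⌈(s * n / t : ℝ≥0)⌉₊ - 1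

variable {t s : ℝ≥0} {n : ℕ}

lemma gridIndex_lt (hs : 0 < s) (hst : s ≤ t) (hn : n ≠ 0) : gridIndex t n s < n := by
  have ht : 0 < t := hs.trans_le hst
  have h1 : ⌈(s * n / t : ℝ≥0)⌉₊ ≤ n := by
    rw [Nat.ceil_le, div_le_iff₀ ht, mul_comm]
    gcongr
  unfold gridIndex
  omega

lemma gridIndex_add_one (hs : 0 < s) (hst : s ≤ t) (hn : n ≠ 0) :
    gridIndex t n s + 1 = ⌈(s * n / t : ℝ≥0)⌉₊ := by
  have ht : 0 < t := hs.trans_le hst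
  have : 0 < ⌈(s * n / t : ℝ≥0)⌉₊ := Nat.ceil_pos.2 (by positivity)
  unfold gridIndex
  omega

lemma le_gridPoint_gridIndex (hs : 0 < s) (hst : s ≤ t) (hn : n ≠ 0) :
    s ≤ gridPoint t n (gridIndex t n s + 1) := by
  have ht : 0 < t := hs.trans_le hst
  have hn' : (0 : ℝ≥0) < n := by positivity
  rw [gridIndex_add_one hs hst hn]
  unfold gridPoint
  rw [le_div_iff₀ hn', mul_comm t, ← div_le_iff₀ ht]
  exact Nat.le_ceil _

lemma gridPoint_gridIndex_lt (hs : 0 < s) (hst : s ≤ t) (hn : n ≠ 0) :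
    gridPoint t n (gridIndex t n s) < s := by
  have ht : 0 < t := hs.trans_le hst
  have hn' : (0 : ℝ≥0) < n := by positivity
  have h := gridIndex_add_one hs hst hn
  have h2 : gridIndex t n s < ⌈(s * n / t : ℝ≥0)⌉₊ := by omega
  unfold gridPoint
  rw [div_lt_iff₀ hn', mul_comm t, ← lt_div_iff₀ ht]
  exact Nat.lt_ceil.1 h2

lemma gridPoint_succ (t : ℝ≥0) (n k : ℕ) : gridPoint t n (k + 1) = gridPoint t n k + t / n := by
  unfold gridPoint
  push_cast
  rw [mul_add, add_div, mul_one]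

lemma tendsto_div_nat_zero (t : ℝ≥0) : Tendsto (fun n : ℕ => t / n) atTop (𝓝 0) := by
  rw [← NNReal.tendsto_coe]
  push_cast
  exact tendsto_const_div_atTop_nhds_zero_nat (t : ℝ)

/-- The grid intervals are open on the left and closed on the right: right endpoints tend to `s`
within `[s, ∞)` and left endpoints strictly from below. For a càdlàg path, the increment over the
interval containing `s` therefore tends to the jump at `s`. -/
lemma tendsto_gridPoint_right (hs : 0 < s) (hst : s ≤ t) :
    Tendsto (fun n => gridPoint t n (gridIndex t n s + 1)) atTop (𝓝[≥] s) := by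
  refine tendsto_nhdsWithin_iff.2 ⟨?_, ?_⟩
  · refine tendsto_of_tendsto_of_tendsto_of_le_of_le' tendsto_const_nhds
      (h := fun n : ℕ => s + t / n) ?_ ?_ ?_
    · simpa using (tendsto_div_nat_zero t).const_add s
    · filter_upwards [eventually_ne_atTop 0] with n hn using le_gridPoint_gridIndex hs hst hn
    · filter_upwards [eventually_ne_atTop 0] with n hn
      rw [gridPoint_succ]
      have := (gridPoint_gridIndex_lt hs hst hn).le
      gcongr
  · filter_upwards [eventually_ne_atTop 0] with n hn using le_gridPoint_gridIndex hs hst hn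

lemma tendsto_gridPoint_left (hs : 0 < s) (hst : s ≤ t) :
    Tendsto (fun n => gridPoint t n (gridIndex t n s)) atTop (𝓝[<] s) := by
  refine tendsto_nhdsWithin_iff.2 ⟨?_, ?_⟩
  · refine tendsto_of_tendsto_of_tendsto_of_le_of_le' (g := fun n : ℕ => s - t / n)
      ?_ tendsto_const_nhds ?_ ?_
    · simpa using (tendsto_const_nhds (x := s)).sub (tendsto_div_nat_zero t)
    · filter_upwards [eventually_ne_atTop 0] with n hn
      rw [tsub_le_iff_right, ← gridPoint_succ]
      exact le_gridPoint_gridIndex hs hst hn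
    · filter_upwards [eventually_ne_atTop 0] with n hn using (gridPoint_gridIndex_lt hs hst hn).le
  · filter_upwards [eventually_ne_atTop 0] with n hn using gridPoint_gridIndex_lt hs hst hn

lemma eventually_gridIndex_ne {s' : ℝ≥0} (hs : 0 < s) (hst : s ≤ t) (hs' : 0 < s') (hst' : s' ≤ t)
    (h : s ≠ s') : ∀ᶠ n in atTop, gridIndex t n s ≠ gridIndex t n s' := by
  have h1 := (tendsto_gridPoint_left hs hst).mono_right nhdsWithin_le_nhds
  have h2 := (tendsto_gridPoint_left hs' hst').mono_right nhdsWithin_le_nhds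
  obtain ⟨U, V, hU, hV, hsU, hsV, hd⟩ := t2_separation h
  filter_upwards [h1 (hU.mem_nhds hsU), h2 (hV.mem_nhds hsV)] with n hn hn' he
  simp only [Set.mem_preimage] at hn hn'
  rw [he] at hn
  exact Set.disjoint_left.1 hd hn hn'

end Grid

/-! ### Jumps of càdlàg paths -/

section CadlagPaths

variable {f : ℝ≥0 → ℝ}

lemma IsCadlagPath.tendsto_leftLim (hf : IsCadlagPath f) (s : ℝ≥0) :
    Tendsto f (𝓝[<] s) (𝓝 (Function.leftLim f s)) :=
  tendsto_leftLim_of_tendsto (hf s).2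

lemma IsCadlagPath.tendsto_right (hf : IsCadlagPath f) (s : ℝ≥0) :
    Tendsto f (𝓝[≥] s) (𝓝 (f s)) :=
  continuousWithinAt_Ioi_iff_Ici.1 (hf s).1

lemma leftLim_nnreal_zero (f : ℝ≥0 → ℝ) : Function.leftLim f 0 = f 0 :=
  leftLim_eq_of_isBot fun _ => zero_le

/-- One-sided limits give local bounds, and compactness of `[0, t]` makes them global. The bound is
a natural number so that only countably many levels `L` are needed. -/
lemma IsCadlagPath.exists_bound (hf : IsCadlagPath f) (t : ℝ≥0) :
    ∃ C : ℕ, ∀ s ≤ t, |f s| ≤ C := by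
  have : ∃ C : ℝ, ∀ s ∈ Set.Icc 0 t, |f s| ≤ C := by
    refine (isCompact_Icc (a := (0 : ℝ≥0)) (b := t)).induction_on
      (p := fun U => ∃ C : ℝ, ∀ s ∈ U, |f s| ≤ C) ⟨0, by simp⟩ ?_ ?_ ?_
    · rintro A B hAB ⟨C, hC⟩; exact ⟨C, fun s hs => hC s (hAB hs)⟩
    · rintro A B ⟨C, hC⟩ ⟨D, hD⟩
      refine ⟨max C D, fun s hs => hs.elim (fun h => (hC s h).trans (le_max_left _ _))
        fun h => (hD s h).trans (le_max_right _ _)⟩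
    · intro s _
      have h1 := (hf.tendsto_leftLim s).abs.eventually_lt_const (lt_add_one _)
      have h2 := (hf.tendsto_right s).abs.eventually_lt_const (lt_add_one _)
      have h3 : ∀ᶠ r in 𝓝 s, |f r| ≤ max (|Function.leftLim f s| + 1) (|f s| + 1) := by
        rw [← nhdsLT_sup_nhdsGE s, eventually_sup]
        exact ⟨h1.mono fun r hr => hr.le.trans (le_max_left _ _),
          h2.mono fun r hr => hr.le.trans (le_max_right _ _)⟩
      exact ⟨_, nhdsWithin_le_nhds h3, _, fun r hr => hr⟩
  obtain ⟨C, hC⟩ := this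
  obtain ⟨m, hm⟩ := exists_nat_ge C
  exact ⟨m, fun s hs => (hC s ⟨zero_le, hs⟩).trans hm⟩

/-- If the grid sums of squared increments do not tend to infinity, then they dominate the sums of
squared jumps. -/
lemma IsCadlagPath.sum_sq_jump_le (hf : IsCadlagPath f) {t : ℝ≥0} {C : ℝ}
    (hC : ∃ᶠ n in atTop, gridSquareSum f t n ≤ C) (F : Finset ℝ≥0) (hF : ∀ s ∈ F, s ≤ t) :
    ∑ s ∈ F, (f s - Function.leftLim f s) ^ 2 ≤ C := by
  classical
  -- The time `0` lies in no interval that is open on the left, but the jump there is zero by the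
  -- convention for the left limit.
  have hF' : ∑ s ∈ F, (f s - Function.leftLim f s) ^ 2 =
      ∑ s ∈ F with 0 < s, (f s - Function.leftLim f s) ^ 2 := by
    rw [Finset.sum_filter]
    refine Finset.sum_congr rfl fun s _ => ?_
    split_ifs with h
    · rfl
    · rw [nonpos_iff_eq_zero.1 (not_lt.1 h), leftLim_nnreal_zero]; simp
  rw [hF']
  set G := F.filter (0 < ·) with hG
  have hG0 : ∀ s ∈ G, 0 < s ∧ s ≤ t := fun s hs =>
    ⟨(Finset.mem_filter.1 hs).2, hF s (Finset.mem_filter.1 hs).1⟩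
  have hlim : Tendsto (fun n => ∑ s ∈ G, (f (gridPoint t n (gridIndex t n s + 1)) -
      f (gridPoint t n (gridIndex t n s))) ^ 2) atTop
      (𝓝 (∑ s ∈ G, (f s - Function.leftLim f s) ^ 2)) := by
    refine tendsto_finsetSum _ fun s hs => ?_
    obtain ⟨h0, h1⟩ := hG0 s hs
    exact (((hf.tendsto_right s).comp (tendsto_gridPoint_right h0 h1)).sub
      ((hf.tendsto_leftLim s).comp (tendsto_gridPoint_left h0 h1))).pow 2
  -- Once the mesh separates the points of `G`, the selected increments form a genuine subsum of the
  -- grid sum.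
  have hinj : ∀ᶠ n in atTop, Set.InjOn (gridIndex t n) G := by
    have : ∀ᶠ n in atTop, ∀ s ∈ G, ∀ s' ∈ G, s ≠ s' → gridIndex t n s ≠ gridIndex t n s' := by
      rw [Filter.eventually_all_finset]
      intro s hs
      rw [Filter.eventually_all_finset]
      intro s' hs'
      by_cases h : s = s'
      · simp [h]
      · filter_upwards [eventually_gridIndex_ne (hG0 s hs).1 (hG0 s hs).2 (hG0 s' hs').1
          (hG0 s' hs').2 h] with n hn _ using hn
    filter_upwards [this] with n hn s hs s' hs' he
    by_contra h
    exact hn s hs s' hs' h he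
  refine le_of_tendsto_of_frequently hlim ?_
  refine ((hC.and_eventually hinj).and_eventually (eventually_ne_atTop 0)).mono ?_
  rintro n ⟨⟨hn, hi⟩, hn0⟩
  refine le_trans ?_ hn
  unfold gridSquareSum
  rw [← Finset.sum_image (g := gridIndex t n)
    (f := fun k => (f (gridPoint t n (k + 1)) - f (gridPoint t n k)) ^ 2) hi]
  refine Finset.sum_le_sum_of_subset_of_nonneg ?_ fun _ _ _ => sq_nonneg _
  intro k hk
  obtain ⟨s, hs, rfl⟩ := Finset.mem_image.1 hk
  exact Finset.mem_range.2 (gridIndex_lt (hG0 s hs).1 (hG0 s hs).2 hn0)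

end CadlagPaths

/-! ### Square summability of the jumps of a semimartingale -/

section ContinuousTime

variable {Ω : Type*} {mΩ : MeasurableSpace Ω} {P : Measure Ω}

/-- The restriction of a filtration to a grid. -/
noncomputable def gridFiltration (𝓕 : Filtration ℝ≥0 mΩ) (t : ℝ≥0) (n : ℕ) : Filtration ℕ mΩ where
  seq k := 𝓕 (gridPoint t n k)
  mono' _ _ h := 𝓕.mono (gridPoint_mono t n h)
  le' _ := 𝓕.le _

lemma martingale_grid {𝓕 : Filtration ℝ≥0 mΩ} {Y : ℝ≥0 → Ω → ℝ} (hY : Martingale Y 𝓕 P)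
    (t : ℝ≥0) (n : ℕ) :
    Martingale (fun k => Y (gridPoint t n k)) (gridFiltration 𝓕 t n) P :=
  ⟨fun k => hY.1 (gridPoint t n k), fun _ _ h => hY.2 _ _ (gridPoint_mono t n h)⟩

/-- Every grid ends at `t`, so the weak-type bound `2 * L * E|Y t|` does not depend on the mesh. By
Fatou's lemma the liminf of the truncated grid sums is integrable, hence almost surely finite. On a
path bounded by `L` the truncation is inactive. -/
lemma martingale_frequently_gridSquareSum_le [IsFiniteMeasure P] {𝓕 : Filtration ℝ≥0 mΩ}
    {Y : ℝ≥0 → Ω → ℝ} (hY : Martingale Y 𝓕 P) (t : ℝ≥0) :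
    ∀ᵐ z ∂P, ∀ L : ℕ, (∀ s ≤ t, |Y s z| ≤ L) →
      ∃ C, ∃ᶠ n in atTop, gridSquareSum (fun s => Y s z) t n ≤ C := by
  rw [ae_all_iff]
  intro L
  have hYm : ∀ s, Measurable (Y s) := fun s => ((hY.1 s).mono (𝓕.le s)).measurable
  set g : ℕ → Ω → ℝ≥0∞ := fun n =>
    (stayBounded (fun k => Y (gridPoint t n k)) L n).indicator
      (fun z => ENNReal.ofReal (gridSquareSum (fun s => Y s z) t n)) with hg
  have hgm : ∀ n, Measurable (g n) := fun n => by
    refine Measurable.indicator (ENNReal.measurable_ofReal.comp ?_)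
      ((gridFiltration 𝓕 t n).le n _ (measurableSet_stayBounded (martingale_grid hY t n).1 L n))
    unfold gridSquareSum
    exact Finset.measurable_fun_sum _ fun k _ => ((hYm _).sub (hYm _)).pow_const 2
  have hfin : ∫⁻ z, liminf (fun n => g n z) atTop ∂P ≠ ⊤ := by
    refine ((lintegral_liminf_le hgm).trans
      (liminf_le_of_frequently_le' (x := ENNReal.ofReal (2 * L * ∫ z, |Y t z| ∂P)) ?_)).trans_lt
      ENNReal.ofReal_lt_top |>.ne
    refine Eventually.frequently ?_
    filter_upwards [eventually_ne_atTop 0] with n hn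
    have := integral_square_function_le (martingale_grid hY t n) (Nat.cast_nonneg L) n
    rw [gridPoint_self t hn] at this
    exact this
  filter_upwards [ae_lt_top (Measurable.liminf hgm) hfin] with z hz hb
  have hgz : ∀ n, g n z = ENNReal.ofReal (gridSquareSum (fun s => Y s z) t n) := fun n =>
    Set.indicator_of_mem (s := stayBounded (fun k => Y (gridPoint t n k)) L n)
      (fun j hj => hb _ (gridPoint_le t hj)) _
  obtain ⟨c, hc1, hc2⟩ := ENNReal.lt_iff_exists_nnreal_btwn.1 hz
  refine ⟨c, (frequently_lt_of_liminf_lt (by isBoundedDefault) hc1).mono fun n hn => ?_⟩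
  rw [hgz] at hn
  have := (ENNReal.ofReal_le_iff_le_toReal ENNReal.coe_ne_top).1 hn.le
  simpa using this

lemma IsCadlagLocalMartingale.frequently_gridSquareSum_le [IsFiniteMeasure P]
    {𝓕 : Filtration ℝ≥0 mΩ} {M : ℝ≥0 → Ω → ℝ} (hM : IsCadlagLocalMartingale 𝓕 P M) (t : ℝ≥0) :
    ∀ᵐ z ∂P, ∃ C, ∃ᶠ n in atTop, gridSquareSum (fun s => M s z) t n ≤ C := by
  obtain ⟨τ, hτ, hmart⟩ := hM.localMartingale
  filter_upwards [hM.cadlag, hτ.tendsto_top,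
    ae_all_iff.2 fun n => martingale_frequently_gridSquareSum_le (hmart n) t] with z h1 h2 h3
  -- Choosing `n` with `t < τ n z` makes both the stopping and the indicator invisible on `[0, t]`.
  obtain ⟨n, hn⟩ := (h2.eventually_const_lt (WithTop.coe_lt_top t)).exists
  have heq : ∀ s ≤ t,
      stoppedProcess (fun i => {z | ⊥ < τ n z}.indicator (M i)) (τ n) s z = M s z := by
    intro s hs
    have hs' : (s : WithTop ℝ≥0) ≤ τ n z := (WithTop.coe_le_coe.2 hs).trans hn.le
    simp only [stoppedProcess, min_eq_left hs']
    exact Set.indicator_of_mem (s := {z | ⊥ < τ n z}) (bot_le.trans_lt hn) _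
  obtain ⟨L, hL⟩ := h1.exists_bound t
  obtain ⟨C, hC⟩ := h3 n L fun s hs => by rw [heq s hs]; exact hL s hs
  refine ⟨C, hC.mono fun m hm => ?_⟩
  rwa [gridSquareSum_congr heq] at hm

lemma IsSemimartingale.cadlag {𝓕 : Filtration ℝ≥0 mΩ} {Z : ℝ≥0 → Ω → ℝ}
    (hZ : IsSemimartingale 𝓕 P Z) : ∀ᵐ z ∂P, IsCadlagPath (fun s => Z s z) := by
  obtain ⟨M, A, hM, hA, h⟩ := hZ.decomposition
  filter_upwards [hM.cadlag, hA.cadlag, h] with z h1 h2 h3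
  simp only [h3]
  intro s
  refine ⟨(h1 s).1.add (h2 s).1, ?_⟩
  obtain ⟨y, hy⟩ := (h1 s).2
  obtain ⟨y', hy'⟩ := (h2 s).2
  exact ⟨y + y', hy.add hy'⟩

lemma IsSemimartingale.sum_sq_jump_le [IsFiniteMeasure P] {𝓕 : Filtration ℝ≥0 mΩ}
    {Z : ℝ≥0 → Ω → ℝ} (hZ : IsSemimartingale 𝓕 P Z) (t : ℝ≥0) :
    ∀ᵐ z ∂P, ∃ C, ∀ F : Finset ℝ≥0, (∀ s ∈ F, s ≤ t) → ∑ s ∈ F, jump Z s z ^ 2 ≤ C := by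
  have hcad := hZ.cadlag
  obtain ⟨M, A, hM, hA, h⟩ := hZ.decomposition
  filter_upwards [hcad, hM.frequently_gridSquareSum_le t, hA.variation, h] with z h1 ⟨C, hC⟩ h2 h3
  obtain ⟨D, hD⟩ := exists_gridSquareSum_le_of_boundedVariation h2 t
  -- The martingale part is controlled only along a subsequence and the finite variation part along
  -- all grids, so the sum is controlled along the same subsequence.
  refine ⟨2 * C + 2 * D, fun F hF => h1.sum_sq_jump_le (hC.mono fun n hn => ?_) F hF⟩
  simp only [h3]
  refine (gridSquareSum_add_le _ _ t n).trans ?_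
  linarith [hD n]

/-- Along stopping times with disjoint graphs, the jumps of a semimartingale before a fixed time
are almost surely square summable. -/
lemma IsSemimartingale.summable_sq_jumpCoeff [IsFiniteMeasure P] {𝓕 : Filtration ℝ≥0 mΩ}
    {Z : ℝ≥0 → Ω → ℝ} (hZ : IsSemimartingale 𝓕 P Z) {T : ℕ → Ω → WithTop ℝ≥0}
    (hT : AbsorbsJumps 𝓕 P Z T) (t : ℝ≥0) :
    ∀ᵐ z ∂P, Summable (fun n => jumpCoeff Z T t n z ^ 2) := by
  classical
  filter_upwards [hZ.sum_sq_jump_le t, hT.disjoint] with z ⟨C, hC⟩ hd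
  refine summable_of_sum_le (fun n => sq_nonneg _) (c := C) fun I => ?_
  set J := I.filter (fun n => T n z ≤ t)
  have hJ : ∀ n ∈ J, T n z ≤ t := fun n hn => (Finset.mem_filter.1 hn).2
  have hcoe : ∀ n ∈ J, ((T n z).untopA : WithTop ℝ≥0) = T n z := fun n hn => by
    rw [WithTop.untopA_eq_untop (ne_top_of_le_ne_top WithTop.coe_ne_top (hJ n hn)),
      WithTop.coe_untop]
  -- Disjointness of the graphs allows coincidences only at `⊤`, which the condition `T n z ≤ t`
  -- excludes; no jump is counted twice.
  have hinj : Set.InjOn (fun n => (T n z).untopA) J := by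
    intro m hm n hn he
    by_contra hne
    have h1 : T m z = T n z := by
      rw [← hcoe m hm, ← hcoe n hn]; exact congrArg _ he
    have := hJ m hm
    rw [hd m n hne h1] at this
    exact WithTop.coe_ne_top (top_le_iff.1 this)
  calc ∑ n ∈ I, jumpCoeff Z T t n z ^ 2 = ∑ n ∈ J, jump Z (T n z).untopA z ^ 2 := by
        rw [Finset.sum_filter]
        refine Finset.sum_congr rfl fun n _ => ?_
        unfold jumpCoeff
        split_ifs <;> simp
    _ = ∑ s ∈ J.image (fun n => (T n z).untopA), jump Z s z ^ 2 :=
        (Finset.sum_image (f := fun s => jump Z s z ^ 2) hinj).symm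
    _ ≤ C := hC _ fun s hs => by
        obtain ⟨n, hn, rfl⟩ := Finset.mem_image.1 hs
        exact WithTop.coe_le_coe.1 ((hcoe n hn).trans_le (hJ n hn))

end ContinuousTime

/-! ### Measurability of jumps at random times -/

section RandomTimes

variable {Ω : Type*} {mΩ : MeasurableSpace Ω} {P : Measure Ω}

lemma tendsto_floor_add_one_div (s : ℝ≥0) :
    Tendsto (fun m : ℕ => ((⌊s * (m + 1)⌋₊ + 1 : ℕ) : ℝ≥0) / (m + 1)) atTop (𝓝[≥] s) := by
  have hle : ∀ m : ℕ, s ≤ ((⌊s * (m + 1)⌋₊ + 1 : ℕ) : ℝ≥0) / (m + 1) := fun m => by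
    rw [le_div_iff₀ (by positivity)]
    push_cast
    exact (Nat.lt_floor_add_one _).le
  refine tendsto_nhdsWithin_iff.2 ⟨?_, Eventually.of_forall hle⟩
  refine tendsto_of_tendsto_of_tendsto_of_le_of_le tendsto_const_nhds
    (h := fun m : ℕ => s + 1 / ((m : ℝ≥0) + 1)) ?_ hle fun m => ?_
  · simpa using (NNReal.tendsto_coe.1 (by
      simpa using tendsto_one_div_add_atTop_nhds_zero_nat (𝕜 := ℝ)) :
      Tendsto (fun m : ℕ => 1 / ((m : ℝ≥0) + 1)) atTop (𝓝 0)).const_add s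
  · dsimp only
    rw [div_le_iff₀ (by positivity), add_mul, one_div,
      inv_mul_cancel₀ (by positivity : (m : ℝ≥0) + 1 ≠ 0)]
    push_cast
    gcongr
    exact Nat.floor_le zero_le

/-- A right-continuous process is measurable at a random time. -/
lemma aemeasurable_eval_randomTime {Z : ℝ≥0 → Ω → ℝ} (hZm : ∀ s, Measurable (Z s))
    (hZ : ∀ᵐ z ∂P, IsCadlagPath (fun s => Z s z)) {S : Ω → ℝ≥0} (hS : Measurable S) :
    AEMeasurable (fun z => Z (S z) z) P := by
  refine aemeasurable_of_tendsto_metrizable_ae' (f := fun (m : ℕ) z =>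
    Z (((⌊S z * (m + 1)⌋₊ + 1 : ℕ) : ℝ≥0) / (m + 1)) z) (fun m => ?_) ?_
  -- The approximating time takes countably many values, so measurability of each `Z s` is enough.
  · have h1 : Measurable (fun q : ℕ × Ω => Z (((q.1 + 1 : ℕ) : ℝ≥0) / (m + 1)) q.2) :=
      measurable_from_prod_countable_right fun k =>
        hZm (((k + 1 : ℕ) : ℝ≥0) / (m + 1))
    have h2 : Measurable (fun z => (⌊S z * (m + 1)⌋₊, z)) :=
      (Nat.measurable_floor.comp (hS.mul_const _)).prodMk measurable_id
    exact (h1.comp h2).aemeasurable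
  · filter_upwards [hZ] with z hz
    exact (hz.tendsto_right (S z)).comp (tendsto_floor_add_one_div (S z))

lemma tendsto_sub_one_div_left {s : ℝ≥0} (hs : 0 < s) :
    Tendsto (fun m : ℕ => s - 1 / ((m : ℝ≥0) + 1)) atTop (𝓝[<] s) := by
  refine tendsto_nhdsWithin_iff.2 ⟨?_, Eventually.of_forall fun m => ?_⟩
  · simpa using (tendsto_const_nhds (x := s)).sub (NNReal.tendsto_coe.1 (by
      simpa using tendsto_one_div_add_atTop_nhds_zero_nat (𝕜 := ℝ)) :
      Tendsto (fun m : ℕ => 1 / ((m : ℝ≥0) + 1)) atTop (𝓝 0))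
  · exact tsub_lt_self hs (by positivity)

lemma aemeasurable_jump_randomTime {Z : ℝ≥0 → Ω → ℝ} (hZm : ∀ s, Measurable (Z s))
    (hZ : ∀ᵐ z ∂P, IsCadlagPath (fun s => Z s z)) {S : Ω → ℝ≥0} (hS : Measurable S) :
    AEMeasurable (fun z => jump Z (S z) z) P := by
  refine (aemeasurable_eval_randomTime hZm hZ hS).sub ?_
  refine aemeasurable_of_tendsto_metrizable_ae' (f := fun (m : ℕ) z =>
    Z (S z - 1 / ((m : ℝ≥0) + 1)) z)
    (fun m => aemeasurable_eval_randomTime hZm hZ (hS.sub_const _)) ?_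
  filter_upwards [hZ] with z hz
  rcases eq_zero_or_pos (S z) with h | h
  -- Truncated subtraction keeps the approximating times at `0`, matching the convention for the
  -- left limit there.
  · simp [h, leftLim_nnreal_zero]
  · exact (hz.tendsto_leftLim (S z)).comp (tendsto_sub_one_div_left h)

lemma IsStoppingTime.measurable_ambient {𝓕 : Filtration ℝ≥0 mΩ} {τ : Ω → WithTop ℝ≥0}
    (hτ : IsStoppingTime 𝓕 τ) : Measurable τ :=
  hτ.measurable.mono hτ.measurableSpace_le le_rfl

lemma IsSemimartingale.aemeasurable_jumpCoeff {𝓕 : Filtration ℝ≥0 mΩ}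
    {Z : ℝ≥0 → Ω → ℝ} (hZ : IsSemimartingale 𝓕 P Z) {T : ℕ → Ω → WithTop ℝ≥0}
    (hT : AbsorbsJumps 𝓕 P Z T) (t : ℝ≥0) (n : ℕ) :
    AEMeasurable (jumpCoeff Z T t n) P := by
  have h := aemeasurable_jump_randomTime (fun s => ((hZ.adapted s).mono (𝓕.le s)).measurable)
    hZ.cadlag (IsStoppingTime.measurable_ambient (hT.stopping n)).untopA
  have hs : MeasurableSet {z | T n z ≤ t} := 𝓕.le t _ (hT.stopping n t)
  -- The default value of `untopA` at `⊤` is harmless, because the indicator vanishes there.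
  convert! h.indicator hs using 1
  ext z
  by_cases hz : T n z ≤ t
  · rw [jumpCoeff, if_pos hz, Set.indicator_of_mem (s := {z | T n z ≤ t}) hz]
  · rw [jumpCoeff, if_neg hz, Set.indicator_of_notMem (s := {z | T n z ≤ t}) hz]

end RandomTimes

/-! ### Wiener quadratic forms -/

/-- The `r`-th derivative of `x ↦ x ^ 2`. -/
noncomputable def sqDeriv (r : ℕ) (x : ℝ) : ℝ := Nat.descFactorial 2 r * x ^ (2 - r)

/-- A bound for `x ↦ x ^ 2` and all its derivatives. -/
noncomputable def sqDerivBound (x : ℝ) : ℝ := x ^ 2 + 2 * |x| + 2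

lemma sqDerivBound_nonneg (x : ℝ) : 0 ≤ sqDerivBound x := by
  unfold sqDerivBound; positivity

lemma abs_sqDeriv_le (r : ℕ) (x : ℝ) : |sqDeriv r x| ≤ sqDerivBound x := by
  unfold sqDeriv sqDerivBound
  match r with
  | 0 =>
    simp only [Nat.descFactorial_zero, Nat.cast_one, one_mul, tsub_zero, abs_pow, sq_abs]
    linarith [abs_nonneg x]
  | 1 =>
    simp only [Nat.descFactorial_one, Nat.cast_ofNat, abs_mul, Nat.abs_ofNat,
      Nat.add_one_sub_one, pow_one]
    linarith [sq_nonneg x]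
  | 2 =>
    have h : |((Nat.descFactorial 2 2 : ℕ) : ℝ) * x ^ (2 - 2)| = 2 := by simp [Nat.descFactorial]
    rw [h]
    linarith [abs_nonneg x, sq_nonneg x]
  | r + 3 =>
    rw [Nat.descFactorial_eq_zero_iff_lt.2 (by omega), Nat.cast_zero, zero_mul, abs_zero]
    positivity

lemma measurable_sqDerivBound : Measurable sqDerivBound := by
  unfold sqDerivBound; fun_prop

lemma memLp_sqDerivBound {p : ℝ≥0∞} (hp : p ≠ ⊤) :
    MemLp sqDerivBound p (gaussianReal 0 1) := by
  have h2 : MemLp (fun x : ℝ => x ^ 2) p (gaussianReal 0 1) := by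
    have := (memLp_id_gaussianReal' (μ := 0) (v := 1) (p * 2)
      (ENNReal.mul_ne_top hp (by norm_num))).norm_rpow_div 2
    rw [ENNReal.mul_div_cancel_right (by norm_num) (by norm_num)] at this
    simpa using this
  have h1 : MemLp (fun x : ℝ => 2 * |x|) p (gaussianReal 0 1) :=
    (memLp_id_gaussianReal' (μ := 0) (v := 1) p hp).abs.const_mul 2
  exact (h2.add h1).add (memLp_const 2)

/-- The embedding of `ℓ¹` in `ℓ²`. It is crude but sufficient, since the coefficients of the
quadratic forms are summable. -/
lemma ENNReal.rpow_half_tsum_sq_le {ι : Type*} (x : ι → ℝ≥0∞) :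
    (∑' a, x a ^ 2) ^ (1 / 2 : ℝ) ≤ ∑' a, x a := by
  have h : ∑' a, x a ^ 2 ≤ (∑' a, x a) ^ 2 := by
    rw [sq, ← ENNReal.tsum_mul_right]
    refine ENNReal.tsum_le_tsum fun a => ?_
    rw [sq]
    gcongr
    exact ENNReal.le_tsum a
  calc (∑' a, x a ^ 2) ^ (1 / 2 : ℝ) ≤ ((∑' a, x a) ^ 2) ^ (1 / 2 : ℝ) := by gcongr
    _ = ∑' a, x a := by
      rw [← ENNReal.rpow_natCast, ← ENNReal.rpow_mul]; norm_num

section Wiener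

variable {W H : Type*} [AddCommGroup W] [Module ℝ W] [TopologicalSpace W] [MeasurableSpace W]
  [NormedAddCommGroup H] [InnerProductSpace ℝ H]

lemma IsAbstractWienerSpace.map_divergence {i : H →L[ℝ] W} {μ : Measure W}
    (hW : IsAbstractWienerSpace i μ) {l : StrongDual ℝ W} {h : H} (hl : IsDivergence i l h)
    (hh : ‖h‖ = 1) : μ.map l = gaussianReal 0 1 := by
  have h1 : l.comp i = innerSL ℝ h := by
    ext k; exact hl k
  have h2 : ‖innerSL ℝ h‖₊ = 1 := by
    ext; simp [hh]
  rw [hW.gaussian, h1, h2, one_pow]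

/-- The diagonal quadratic form `∑_{j ∈ s} c_j (δe_j)²`, where `δe_j = l j`. -/
noncomputable def diagForm (l : ℕ → StrongDual ℝ W) (c : ℕ → ℝ) (s : Finset ℕ) (w : W) : ℝ :=
  ∑ j ∈ s, c j * l j w ^ 2

lemma isSmoothCylindrical_diagForm (l : ℕ → StrongDual ℝ W) (c : ℕ → ℝ) (n : ℕ) :
    IsSmoothCylindrical (diagForm l c (Finset.range n)) := by
  refine ⟨n, fun a => l a, fun x => ∑ a : Fin n, c a * x a ^ 2, ?_, fun w => ?_⟩
  · refine Function.HasTemperateGrowth.sum fun a _ => ?_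
    exact (Function.HasTemperateGrowth.const _).mul
      ((ContinuousLinearMap.proj (R := ℝ) (φ := fun _ : Fin n => ℝ) a).hasTemperateGrowth.pow 2)
  · exact Finset.sum_range _

variable {i : H →L[ℝ] W} {e : HilbertBasis ℕ ℝ H} {l : ℕ → StrongDual ℝ W}

/-- The coefficients of the derivatives of a diagonal quadratic form. -/
noncomputable def diagCoeff (l : ℕ → StrongDual ℝ W) (c : ℕ → ℝ) (r : ℕ) (w : W) (j : ℕ) (a : Fin r → ℕ) : ℝ :=
  if ∀ q, a q = j then c j * sqDeriv r (l j w) else 0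

/-- Each summand depends on a single coordinate `⟪e j, h⟫`, so by orthonormality its derivative sees
only the constant multi-index `j`. For `r = 0` the condition is vacuous and every `j` contributes to
the one empty multi-index. -/
lemma hDeriv_diagForm (hl : ∀ n, IsDivergence i (l n) (e n)) (c : ℕ → ℝ) (s : Finset ℕ) (r : ℕ)
    (w : W) (a : Fin r → ℕ) :
    hDeriv i r (diagForm l c s) w (fun q => e (a q)) = ∑ j ∈ s, diagCoeff l c r w j a := by
  have hF : (fun h : H => diagForm l c s (w + i h)) =
      fun h => ∑ j ∈ s, ((fun x : ℝ => c j * (l j w + x) ^ 2) ∘ innerSL ℝ (e j)) h := by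
    ext h
    refine Finset.sum_congr rfl fun j _ => ?_
    simp only [map_add, Function.comp_apply, hl j h, innerSL_apply_apply]
  have hg : ∀ j, ContDiff ℝ r (fun x : ℝ => c j * (l j w + x) ^ 2) := fun j => by fun_prop
  unfold hDeriv
  rw [hF, iteratedFDeriv_fun_sum_apply fun j _ =>
    ((hg j).comp (innerSL ℝ (e j)).contDiff).contDiffAt, sum_apply]
  refine Finset.sum_congr rfl fun j _ => ?_
  rw [ContinuousLinearMap.iteratedFDeriv_comp_right _ (hg j) _ le_rfl,
    ContinuousMultilinearMap.compContinuousLinearMap_apply,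
    iteratedFDeriv_apply_eq_iteratedDeriv_mul_prod,
    iteratedDeriv_const_mul_field, iteratedDeriv_comp_const_add (f := fun x : ℝ => x ^ 2)]
  simp only [iteratedDeriv_pow, innerSL_apply_apply, map_zero, add_zero, orthonormal_iff_ite.1 e.orthonormal]
  unfold diagCoeff sqDeriv
  split_ifs with h
  · simp [h]
  · obtain ⟨q, hq⟩ := not_forall.1 h
    rw [Finset.prod_eq_zero (Finset.mem_univ q) (if_neg (Ne.symm hq)), zero_smul]

/-- No cancellation occurs: for `r = 0` all terms are nonnegative, and for `r ≥ 1` only `j = a 0`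
can contribute. This makes Sobolev norms of partial sums monotone, so that they converge to their
supremum. -/
lemma diagCoeff_sum_mono {c : ℕ → ℝ} (hc : ∀ j, 0 ≤ c j) {s s' : Finset ℕ} (hs : s ⊆ s') (r : ℕ)
    (w : W) (a : Fin r → ℕ) :
    ‖∑ j ∈ s, diagCoeff l c r w j a‖ ≤ ‖∑ j ∈ s', diagCoeff l c r w j a‖ := by
  rcases r with _ | r
  · have h0 : ∀ j, 0 ≤ diagCoeff l c 0 w j a := fun j => by
      simp only [diagCoeff, sqDeriv, IsEmpty.forall_iff, if_true]
      have := hc j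
      simp only [Nat.descFactorial_zero, Nat.cast_one, one_mul, tsub_zero]
      positivity
    rw [Real.norm_of_nonneg (Finset.sum_nonneg fun j _ => h0 j),
      Real.norm_of_nonneg (Finset.sum_nonneg fun j _ => h0 j)]
    exact Finset.sum_le_sum_of_subset_of_nonneg hs fun j _ _ => h0 j
  · have key : ∀ s : Finset ℕ, ∑ j ∈ s, diagCoeff l c (r + 1) w j a =
        if a 0 ∈ s then diagCoeff l c (r + 1) w (a 0) a else 0 := fun s => by
      rw [← Finset.sum_ite_eq s (a 0) fun j => diagCoeff l c (r + 1) w j a]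
      refine Finset.sum_congr rfl fun j _ => ?_
      split_ifs with h
      · rfl
      · exact if_neg fun h' => h (h' 0)
    rw [key s, key s']
    by_cases h : a 0 ∈ s
    · rw [if_pos h, if_pos (hs h)]
    · rw [if_neg h, norm_zero]; exact norm_nonneg _

lemma hsNorm_diagForm_mono (hl : ∀ n, IsDivergence i (l n) (e n)) {c : ℕ → ℝ} (hc : ∀ j, 0 ≤ c j)
    {s s' : Finset ℕ} (hs : s ⊆ s') (r : ℕ) (w : W) :
    hsNorm e (hDeriv i r (diagForm l c s) w) ≤ hsNorm e (hDeriv i r (diagForm l c s') w) := by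
  unfold hsNorm
  simp only [hDeriv_diagForm hl]
  gcongr with a
  exact enorm_le_iff_norm_le.2 (diagCoeff_sum_mono hc hs r w a)

lemma hsNorm_diagForm_le (hl : ∀ n, IsDivergence i (l n) (e n)) (c : ℕ → ℝ) (s : Finset ℕ) (r : ℕ)
    (w : W) :
    hsNorm e (hDeriv i r (diagForm l c s) w) ≤ ‖∑ j ∈ s, |c j| * sqDerivBound (l j w)‖ₑ := by
  unfold hsNorm
  simp only [hDeriv_diagForm hl]
  calc _ ≤ ∑' a : Fin r → ℕ, ‖∑ j ∈ s, diagCoeff l c r w j a‖ₑ :=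
        ENNReal.rpow_half_tsum_sq_le _
    _ ≤ ∑' a : Fin r → ℕ, ∑ j ∈ s, ‖diagCoeff l c r w j a‖ₑ :=
        ENNReal.tsum_le_tsum fun a => enorm_sum_le _ _
    _ = ∑ j ∈ s, ∑' a : Fin r → ℕ, ‖diagCoeff l c r w j a‖ₑ :=
        Summable.tsum_finsetSum fun _ _ => ENNReal.summable
    _ ≤ ∑ j ∈ s, ENNReal.ofReal (|c j| * sqDerivBound (l j w)) := by
        refine Finset.sum_le_sum fun j _ => ?_
        rw [tsum_eq_single (fun _ => j) fun a ha => ?_]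
        · rw [diagCoeff, if_pos fun _ => rfl, Real.enorm_eq_ofReal_abs, abs_mul]
          gcongr
          exact abs_sqDeriv_le _ _
        · rw [diagCoeff, if_neg fun h => ha (funext h), enorm_zero]
    _ = _ := by
        rw [← ENNReal.ofReal_sum_of_nonneg fun j _ =>
          mul_nonneg (abs_nonneg _) (sqDerivBound_nonneg _), Real.enorm_of_nonneg]
        exact Finset.sum_nonneg fun j _ => mul_nonneg (abs_nonneg _) (sqDerivBound_nonneg _)

lemma abs_diagForm_le (c : ℕ → ℝ) (s : Finset ℕ) (w : W) :
    ‖diagForm l c s w‖ ≤ ‖∑ j ∈ s, |c j| * sqDerivBound (l j w)‖ := by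
  rw [Real.norm_of_nonneg (r := ∑ j ∈ s, _) (Finset.sum_nonneg fun j _ =>
    mul_nonneg (abs_nonneg _) (sqDerivBound_nonneg _))]
  refine (norm_sum_le _ _).trans (Finset.sum_le_sum fun j _ => ?_)
  rw [Real.norm_eq_abs, abs_mul]
  gcongr
  simpa [sqDeriv] using abs_sqDeriv_le 0 (l j w)

/-! ### Sobolev norms and capacity of Gaussian quadratic forms -/

variable [BorelSpace W] {μ : Measure W}

lemma measurable_diagForm (l : ℕ → StrongDual ℝ W) (c : ℕ → ℝ) (s : Finset ℕ) :
    Measurable (diagForm l c s) :=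
  Finset.measurable_fun_sum _ fun j _ =>
    ((l j).continuous.measurable.pow_const 2).const_mul (c j)

lemma eLpNorm_sum_sqDerivBound_le (hg : ∀ n, μ.map (l n) = gaussianReal 0 1) {p : ℝ≥0∞}
    (hp : 1 ≤ p) (c : ℕ → ℝ) (s : Finset ℕ) :
    eLpNorm (fun w => ∑ j ∈ s, |c j| * sqDerivBound (l j w)) p μ ≤
      (∑ j ∈ s, ENNReal.ofReal |c j|) * eLpNorm sqDerivBound p (gaussianReal 0 1) := by
  have hm : ∀ j, Measurable (fun w => sqDerivBound (l j w)) := fun j =>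
    measurable_sqDerivBound.comp (l j).continuous.measurable
  have h1 := eLpNorm_sum_le (μ := μ) (s := s) (f := fun j w => |c j| * sqDerivBound (l j w))
    (fun j _ => ((hm j).const_mul _).aestronglyMeasurable) hp
  rw [Finset.sum_mul]
  refine (le_of_eq ?_).trans (h1.trans (Finset.sum_le_sum fun j _ => ?_))
  · congr 1; ext w; simp
  · refine (eLpNorm_const_smul_le (c := |c j|) (f := fun w => sqDerivBound (l j w))).trans ?_
    rw [← hg j, eLpNorm_map_measure measurable_sqDerivBound.aestronglyMeasurable
      (l j).continuous.measurable.aemeasurable, Real.enorm_of_nonneg (abs_nonneg _)]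
    rfl

lemma cylSobolevNorm_diagForm_le (hl : ∀ n, IsDivergence i (l n) (e n))
    (hg : ∀ n, μ.map (l n) = gaussianReal 0 1) {p : ℝ} (hp : 1 ≤ p) (k : ℕ)
    (c : ℕ → ℝ) (s : Finset ℕ) :
    cylSobolevNorm i μ e p k (diagForm l c s) ≤
      (k + 1) * ((∑ j ∈ s, ENNReal.ofReal |c j|) *
        eLpNorm sqDerivBound (ENNReal.ofReal p) (gaussianReal 0 1)) := by
  have hp0 : 0 < p := by linarith
  have key : ∀ r, (∫⁻ w, hsNorm e (hDeriv i r (diagForm l c s) w) ^ p ∂μ) ^ (1 / p) ≤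
      (∑ j ∈ s, ENNReal.ofReal |c j|) *
        eLpNorm sqDerivBound (ENNReal.ofReal p) (gaussianReal 0 1) := fun r => by
    refine le_trans ?_ (eLpNorm_sum_sqDerivBound_le hg (p := ENNReal.ofReal p)
      (by simpa using hp) c s)
    rw [eLpNorm_eq_lintegral_rpow_enorm_toReal (by simpa using hp0) ENNReal.ofReal_ne_top,
      ENNReal.toReal_ofReal hp0.le]
    gcongr with w
    exact hsNorm_diagForm_le hl c s r w
  unfold cylSobolevNorm
  refine (Finset.sum_le_card_nsmul _ _ _ fun r _ => key r).trans ?_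
  simp

lemma cylSobolevNorm_diagForm_mono (hl : ∀ n, IsDivergence i (l n) (e n)) {c : ℕ → ℝ}
    (hc : ∀ j, 0 ≤ c j) {s s' : Finset ℕ} (hs : s ⊆ s') {p : ℝ} (hp : 0 ≤ p) (k : ℕ) :
    cylSobolevNorm i μ e p k (diagForm l c s) ≤ cylSobolevNorm i μ e p k (diagForm l c s') := by
  unfold cylSobolevNorm
  gcongr with r _ w
  exact hsNorm_diagForm_mono hl hc hs r w

lemma eLpNorm_diagForm_le (hg : ∀ n, μ.map (l n) = gaussianReal 0 1) {p : ℝ≥0∞}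
    (hp : 1 ≤ p) (c : ℕ → ℝ) (s : Finset ℕ) :
    eLpNorm (diagForm l c s) p μ ≤
      (∑ j ∈ s, ENNReal.ofReal |c j|) * eLpNorm sqDerivBound p (gaussianReal 0 1) :=
  (eLpNorm_mono fun w => abs_diagForm_le c s w).trans (eLpNorm_sum_sqDerivBound_le hg hp c s)

/-- By Tonelli the expected sum is `∑ c j` times the second moment of a standard Gaussian, hence
finite. -/
lemma ae_summable_diagForm (hg : ∀ n, μ.map (l n) = gaussianReal 0 1) {c : ℕ → ℝ}
    (hc : ∀ j, 0 ≤ c j) (hcs : Summable c) : ∀ᵐ w ∂μ, Summable (fun j => c j * l j w ^ 2) := by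
  have hm : ∀ j, Measurable (fun w => ENNReal.ofReal (c j * l j w ^ 2)) := fun j =>
    ENNReal.measurable_ofReal.comp (((l j).continuous.measurable.pow_const 2).const_mul (c j))
  have hκ : ∫⁻ x, ENNReal.ofReal (x ^ 2) ∂(gaussianReal 0 1) ≠ ⊤ :=
    (memLp_id_gaussianReal' (μ := 0) (v := 1) 2 (by norm_num)).integrable_sq.lintegral_lt_top.ne
  have hfin : ∫⁻ w, ∑' j, ENNReal.ofReal (c j * l j w ^ 2) ∂μ ≠ ⊤ := by
    rw [lintegral_tsum fun j => (hm j).aemeasurable]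
    have : ∀ j, ∫⁻ w, ENNReal.ofReal (c j * l j w ^ 2) ∂μ =
        ENNReal.ofReal (c j) * ∫⁻ x, ENNReal.ofReal (x ^ 2) ∂(gaussianReal 0 1) := fun j => by
      have hsq : Measurable (fun x : ℝ => ENNReal.ofReal (x ^ 2)) := by fun_prop
      rw [← hg j, lintegral_map hsq (l j).continuous.measurable,
        ← lintegral_const_mul (ENNReal.ofReal (c j))
          (show Measurable (fun w => ENNReal.ofReal (l j w ^ 2)) from
            hsq.comp (l j).continuous.measurable)]
      simp only [ENNReal.ofReal_mul (hc j)]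
    simp only [this]
    rw [ENNReal.tsum_mul_right]
    exact ENNReal.mul_ne_top hcs.tsum_ofReal_ne_top hκ
  filter_upwards [ae_lt_top (Measurable.tsum hm) hfin] with w hw
  refine (ENNReal.summable_toReal hw.ne).congr fun j => ?_
  exact ENNReal.toReal_ofReal (mul_nonneg (hc j) (sq_nonneg _))

lemma diagForm_sub_of_le (c : ℕ → ℝ) {m n : ℕ} (h : m ≤ n) :
    diagForm l c (Finset.range n) - diagForm l c (Finset.range m) =
      diagForm l c (Finset.Ico m n) := by
  ext w
  simp only [Pi.sub_apply, diagForm]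
  rw [Finset.sum_Ico_eq_sub _ h]

lemma diagForm_sub_of_ge (c : ℕ → ℝ) {m n : ℕ} (h : m ≤ n) :
    diagForm l c (Finset.range m) - diagForm l c (Finset.range n) =
      diagForm l (fun j => - c j) (Finset.Ico m n) := by
  rw [← neg_sub, diagForm_sub_of_le c h]
  ext w
  simp [diagForm]

lemma sum_Ico_le_tsum_add (f : ℕ → ℝ≥0∞) {n₀ m : ℕ} (hm : n₀ ≤ m) (n : ℕ) :
    ∑ j ∈ Finset.Ico m n, f j ≤ ∑' j, f (j + n₀) := by
  refine (Finset.sum_le_sum_of_subset (Finset.Ico_subset_Ico_left hm)).trans ?_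
  rw [Finset.sum_Ico_eq_sum_range]
  simp only [add_comm n₀]
  exact ENNReal.sum_le_tsum _

/-- A nonnegative summable diagonal quadratic form belongs to all Gaussian Sobolev spaces. -/
lemma hasSobolevNorm_diagForm (hl : ∀ n, IsDivergence i (l n) (e n))
    (hg : ∀ n, μ.map (l n) = gaussianReal 0 1) {c : ℕ → ℝ}
    (hc : ∀ j, 0 ≤ c j) (hcs : Summable c) {p : ℝ} (hp : 1 ≤ p) (k : ℕ) :
    HasSobolevNorm i μ e p k (fun w => ∑' j, c j * l j w ^ 2)
      (⨆ n, cylSobolevNorm i μ e p k (diagForm l c (Finset.range n))) := by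
  set κ := eLpNorm sqDerivBound (ENNReal.ofReal p) (gaussianReal 0 1) with hκ
  have hκt : κ ≠ ⊤ := (memLp_sqDerivBound ENNReal.ofReal_ne_top).2.ne
  have hp' : 1 ≤ ENNReal.ofReal p := by simpa using hp
  have hlim : ∀ᵐ w ∂μ, Tendsto (fun n => diagForm l c (Finset.range n) w) atTop
      (𝓝 (∑' j, c j * l j w ^ 2)) := by
    filter_upwards [ae_summable_diagForm hg hc hcs] with w hw using hw.hasSum.tendsto_sum_nat
  have hFm : ∀ n, AEStronglyMeasurable (diagForm l c (Finset.range n)) μ := fun n =>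
    (measurable_diagForm l c _).aestronglyMeasurable
  have htail : Tendsto (fun n => ∑' j, ENNReal.ofReal (c (j + n))) atTop (𝓝 0) :=
    ENNReal.tendsto_sum_nat_add _ hcs.tsum_ofReal_ne_top
  refine ⟨aestronglyMeasurable_of_tendsto_ae atTop hFm hlim,
    fun n => diagForm l c (Finset.range n), fun n => isSmoothCylindrical_diagForm l c n,
    ?_, ?_, ?_⟩
  · have hbound : ∀ n, eLpNorm (diagForm l c (Finset.range n) - fun w => ∑' j, c j * l j w ^ 2)
        (ENNReal.ofReal p) μ ≤ (∑' j, ENNReal.ofReal (c (j + n))) * κ := fun n => by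
      -- Lower semicontinuity of the `L^p` norm under almost sure convergence turns bounds on finite
      -- blocks into a bound on the full remainder.
      refine (Lp.eLpNorm_lim_le_liminf_eLpNorm
        (f := fun m => diagForm l c (Finset.range n) - diagForm l c (Finset.range m))
        (fun m => (hFm n).sub (hFm m)) _ ?_).trans ?_
      · filter_upwards [hlim] with w hw
        exact tendsto_const_nhds.sub hw
      · refine liminf_le_of_frequently_le' (Eventually.frequently ?_)
        filter_upwards [eventually_ge_atTop n] with m hm
        rw [diagForm_sub_of_ge c hm]
        refine (eLpNorm_diagForm_le hg hp' _ _).trans ?_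
        gcongr
        simp only [abs_neg, abs_of_nonneg (hc _)]
        exact sum_Ico_le_tsum_add (fun j => ENNReal.ofReal (c j)) le_rfl m
    refine tendsto_of_tendsto_of_tendsto_of_le_of_le tendsto_const_nhds ?_ (fun _ => zero_le)
      hbound
    simpa using ENNReal.Tendsto.mul_const htail (Or.inr hκt)
  · intro ε hε
    have hlim0 : Tendsto (fun n => ((k : ℝ≥0∞) + 1) * ((∑' j, ENNReal.ofReal (c (j + n))) * κ))
        atTop (𝓝 0) := by
      have := ENNReal.Tendsto.const_mul (a := (k : ℝ≥0∞) + 1)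
        (ENNReal.Tendsto.mul_const htail (Or.inr hκt)) (Or.inr (by simp))
      simpa using this
    obtain ⟨n₀, hn₀⟩ := (hlim0.eventually_lt_const hε).exists
    refine ⟨n₀, fun m hm n hn => le_trans ?_ hn₀.le⟩
    rcases le_total n m with h | h
    · rw [diagForm_sub_of_le c h]
      refine (cylSobolevNorm_diagForm_le hl hg hp k _ _).trans ?_
      gcongr
      simp only [abs_of_nonneg (hc _)]
      exact sum_Ico_le_tsum_add (fun j => ENNReal.ofReal (c j)) hn m
    · rw [diagForm_sub_of_ge c h]
      refine (cylSobolevNorm_diagForm_le hl hg hp k _ _).trans ?_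
      gcongr
      simp only [abs_neg, abs_of_nonneg (hc _)]
      exact sum_Ico_le_tsum_add (fun j => ENNReal.ofReal (c j)) hm n
  · exact tendsto_atTop_iSup fun m n h =>
      cylSobolevNorm_diagForm_mono hl hc (Finset.range_subset_range.2 h) (by linarith) k

/-- The set where a summable diagonal quadratic form is infinite has capacity zero. -/
lemma hasZeroCapacity_not_summable (hl : ∀ n, IsDivergence i (l n) (e n))
    (hg : ∀ n, μ.map (l n) = gaussianReal 0 1) {c : ℕ → ℝ}
    (hc : ∀ j, 0 ≤ c j) (hcs : Summable c) :
    HasZeroCapacity i μ e {w | ¬ Summable (fun j => c j * l j w ^ 2)} := by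
  intro p hp k
  have hp0 : 0 < p := by linarith
  set κ := eLpNorm sqDerivBound (ENNReal.ofReal p) (gaussianReal 0 1) with hκ
  have hκt : κ ≠ ⊤ := (memLp_sqDerivBound ENNReal.ofReal_ne_top).2.ne
  set A : ℝ≥0∞ := (k + 1) * ((∑' j, ENNReal.ofReal (c j)) * κ) with hA
  have hAt : A ≠ ⊤ := ENNReal.mul_ne_top (by simp) (ENNReal.mul_ne_top hcs.tsum_ofReal_ne_top hκt)
  have hcap : ∀ m : ℕ, gaussianCapacity i μ e p k {w | ¬ Summable (fun j => c j * l j w ^ 2)} ≤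
      (ENNReal.ofReal (1 / ((m : ℝ) + 1)) * A) ^ p := fun m => by
    set ρ : ℝ := 1 / ((m : ℝ) + 1) with hρ
    have hρ0 : 0 < ρ := by positivity
    have hc' : ∀ j, 0 ≤ ρ * c j := fun j => mul_nonneg hρ0.le (hc j)
    -- Finite partial sums are continuous on `W`, so `O` is open although the full series is only
    -- measurable. It contains every point of divergence for every `ρ > 0`. Almost everywhere on `O`
    -- the scaled form is at least `1`, and its Sobolev norm is at most `ρ * A`; then `ρ` tends to
    -- `0`.
    set O : Set W := ⋃ n, {w | 1 < diagForm l (fun j => ρ * c j) (Finset.range n) w} with hO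
    have hOo : IsOpen O := isOpen_iUnion fun n =>
      isOpen_lt continuous_const (continuous_finsetSum _ fun j _ =>
        ((l j).continuous.pow 2).const_mul _)
    have hNO : {w | ¬ Summable (fun j => c j * l j w ^ 2)} ⊆ O := by
      intro w hw
      have h1 : ¬ Summable (fun j => ρ * c j * l j w ^ 2) := by
        simp only [mul_assoc]
        rwa [summable_mul_left_iff hρ0.ne']
      rw [not_summable_iff_tendsto_nat_atTop_of_nonneg
        fun j => mul_nonneg (hc' j) (sq_nonneg _)] at h1
      obtain ⟨n, hn⟩ := (h1.eventually_gt_atTop 1).exists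
      exact Set.mem_iUnion.2 ⟨n, hn⟩
    refine le_trans (b := openCapacity i μ e p k O)
      (iInf_le_of_le O (iInf_le_of_le hOo (iInf_le _ hNO))) ?_
    refine le_trans (b := (⨆ n, cylSobolevNorm i μ e p k
        (diagForm l (fun j => ρ * c j) (Finset.range n))) ^ p)
      (iInf_le_of_le _ (iInf_le_of_le _ (iInf_le_of_le
        (hasSobolevNorm_diagForm hl hg hc' (hcs.mul_left ρ) hp.le k) (iInf_le _ ?_)))) ?_
    · filter_upwards [ae_summable_diagForm hg hc' (hcs.mul_left ρ)] with w hw hwO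
      obtain ⟨n, hn⟩ := Set.mem_iUnion.1 hwO
      exact hn.le.trans (hw.sum_le_tsum _ fun j _ => mul_nonneg (hc' j) (sq_nonneg _))
    · gcongr
      refine iSup_le fun n => (cylSobolevNorm_diagForm_le hl hg hp.le k _ _).trans ?_
      simp only [abs_of_nonneg (hc' _), ENNReal.ofReal_mul hρ0.le]
      rw [← Finset.mul_sum, hA]
      calc _ = ENNReal.ofReal ρ *
            (((k : ℝ≥0∞) + 1) * ((∑ j ∈ Finset.range n, ENNReal.ofReal (c j)) * κ)) := by ring
        _ ≤ _ := by
          gcongr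
          exact ENNReal.sum_le_tsum _
  have h1 : Tendsto (fun m : ℕ => ENNReal.ofReal (1 / ((m : ℝ) + 1))) atTop (𝓝 0) := by
    simpa using ENNReal.tendsto_ofReal tendsto_one_div_add_atTop_nhds_zero_nat
  have h2 := (ENNReal.Tendsto.mul_const h1 (Or.inr hAt)).ennrpow_const p
  rw [zero_mul, ENNReal.zero_rpow_of_pos hp0] at h2
  exact nonpos_iff_eq_zero.1 (ge_of_tendsto' h2 hcap)

end Wiener

/-! ### Diagonal operators -/

section DiagonalOperator

variable {H : Type*} [NormedAddCommGroup H] [InnerProductSpace ℝ H] [CompleteSpace H]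

lemma HilbertBasis.summable_smul_iff (e : HilbertBasis ℕ ℝ H) (c : ℕ → ℝ) :
    Summable (fun n => c n • e n) ↔ Summable (fun n => c n ^ 2) := by
  have h := e.orthonormal.orthogonalFamily.summable_iff_norm_sq_summable c
  simpa using h

lemma HilbertBasis.summable_sq_mul_inner_sq (e : HilbertBasis ℕ ℝ H) {a : ℕ → ℝ}
    (ha : Summable (fun n => a n ^ 2)) (h : H) :
    Summable (fun n => (a n * inner ℝ (e n) h) ^ 2) := by
  have h1 : Summable (fun n => ‖inner ℝ (e n) h‖ ^ 2) := e.orthonormal.inner_products_summable h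
  refine (h1.mul_left (∑' n, a n ^ 2)).of_nonneg_of_le (fun n => sq_nonneg _) fun n => ?_
  rw [mul_pow, Real.norm_eq_abs, sq_abs]
  gcongr
  exact ha.le_tsum n fun _ _ => sq_nonneg _

/-- The diagonal operator `∑ a_n e_n ⊗ e_n` with square summable coefficients. -/
lemma HilbertBasis.exists_diagonal (e : HilbertBasis ℕ ℝ H) {a : ℕ → ℝ}
    (ha : Summable (fun n => a n ^ 2)) :
    ∃ D : H →L[ℝ] H, ∀ h, HasSum (fun n => (a n * inner ℝ (e n) h) • e n) (D h) := by
  have hs : ∀ h, HasSum (fun n => (a n * inner ℝ (e n) h) • e n)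
      (∑' n, (a n * inner ℝ (e n) h) • e n) := fun h =>
    ((e.summable_smul_iff _).2 (e.summable_sq_mul_inner_sq ha h)).hasSum
  -- Banach–Steinhaus makes the pointwise limit of the finite-rank truncations bounded.
  refine ⟨continuousLinearMapOfTendsto (l := atTop) (fun N => ∑ n ∈ Finset.range N,
    a n • (innerSL ℝ (e n)).smulRight (e n)) (f := fun h => ∑' n, (a n * inner ℝ (e n) h) • e n) ?_,
    hs⟩
  refine tendsto_pi_nhds.2 fun h => ((hs h).tendsto_sum_nat).congr fun N => ?_
  simp [mul_smul]

end DiagonalOperator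

/-! ### The perturbation of identity -/

section Perturbation

variable {W H : Type*} [AddCommGroup W] [Module ℝ W] [TopologicalSpace W]
  [NormedAddCommGroup H] [InnerProductSpace ℝ H] [CompleteSpace H]
  {Ω : Type*} {Z : ℝ≥0 → Ω → ℝ} {T : ℕ → Ω → WithTop ℝ≥0} {t : ℝ≥0}
  {i : H →L[ℝ] W} {e : HilbertBasis ℕ ℝ H} {l : ℕ → StrongDual ℝ W}

lemma summable_shiftTerm_iff (w : W) (z : Ω) :
    Summable (shiftTerm Z T e l t w z) ↔
      Summable (fun n => jumpCoeff Z T t n z ^ 2 * l n w ^ 2) := by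
  simp only [← mul_pow]
  exact e.summable_smul_iff fun n => jumpCoeff Z T t n z * l n w

lemma shiftTerm_add (hl : ∀ n, IsDivergence i (l n) (e n)) (w : W) (h : H) (z : Ω) (n : ℕ) :
    shiftTerm Z T e l t (w + i h) z n =
      shiftTerm Z T e l t w z n + (jumpCoeff Z T t n z * inner ℝ (e n) h) • e n := by
  simp only [shiftTerm, map_add, hl n h, mul_add, add_smul]

lemma summable_shiftTerm_add (hl : ∀ n, IsDivergence i (l n) (e n)) {z : Ω}
    (hz : Summable fun n => jumpCoeff Z T t n z ^ 2) {w : W}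
    (hw : Summable (shiftTerm Z T e l t w z)) (h : H) :
    Summable (shiftTerm Z T e l t (w + i h) z) := by
  refine (hw.add ((e.summable_smul_iff _).2 (e.summable_sq_mul_inner_sq hz h))).congr fun n => ?_
  exact (shiftTerm_add hl w h z n).symm

lemma shift_add (hl : ∀ n, IsDivergence i (l n) (e n)) {z : Ω} {D : H →L[ℝ] H}
    (hD : ∀ h, HasSum (fun n => (jumpCoeff Z T t n z * inner ℝ (e n) h) • e n) (D h)) {w : W}
    (hw : Summable (shiftTerm Z T e l t w z)) (h : H) :
    shift Z T e l t (w + i h) z = shift Z T e l t w z + D h := by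
  refine HasSum.tsum_eq ((hw.hasSum.add (hD h)).congr_fun ?_)
  exact fun n => shiftTerm_add hl w h z n

/-- With `N` the exact divergence set of the series, the map off `N` is the affine map `h ↦ u(w) + D
h`. Its derivative is therefore `D` at every point. -/
lemma smooth_along_H [MeasurableSpace W] [BorelSpace W] {μ : Measure W}
    (hl : ∀ n, IsDivergence i (l n) (e n)) (hg : ∀ n, μ.map (l n) = gaussianReal 0 1) {z : Ω}
    (hz : Summable fun n => jumpCoeff Z T t n z ^ 2) :
    ∃ (N : Set W) (D : H →L[ℝ] H),
      μ N = 0 ∧ HasZeroCapacity i μ e N ∧ IsHInvariant i N ∧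
      (∀ n, D (e n) = jumpCoeff Z T t n z • e n) ∧
      Summable (fun n => ‖D (e n)‖ ^ 2) ∧
      ∀ w ∉ N,
        (∀ h : H, Summable (shiftTerm Z T e l t (w + i h) z)) ∧
        ContDiff ℝ 1 (fun h : H => shift Z T e l t (w + i h) z) ∧
        ContDiff ℝ ∞ (fun h : H => shift Z T e l t (w + i h) z) ∧
        ∀ h : H, HasFDerivAt (fun k : H => shift Z T e l t (w + i k) z) D h := by
  obtain ⟨D, hD⟩ := e.exists_diagonal hz
  have hDe : ∀ n, D (e n) = jumpCoeff Z T t n z • e n := fun n => by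
    refine (hD (e n)).unique ?_
    have := hasSum_single (f := fun j => (jumpCoeff Z T t j z * inner ℝ (e j) (e n)) • e j) n
      fun j hj => by rw [orthonormal_iff_ite.1 e.orthonormal, if_neg hj, mul_zero, zero_smul]
    simpa [orthonormal_iff_ite.1 e.orthonormal, e.orthonormal.norm_eq_one] using this
  have hN : ∀ w : W, w ∉ {w | ¬ Summable (fun n => jumpCoeff Z T t n z ^ 2 * l n w ^ 2)} ↔
      Summable (shiftTerm Z T e l t w z) := fun w => by
    rw [summable_shiftTerm_iff, Set.mem_ofPred_eq, not_not]
  refine ⟨{w | ¬ Summable (fun n => jumpCoeff Z T t n z ^ 2 * l n w ^ 2)}, D,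
    ae_summable_diagForm hg (fun n => sq_nonneg _) hz,
    hasZeroCapacity_not_summable hl hg (fun n => sq_nonneg _) hz, fun w hw h => ?_, hDe, ?_,
    fun w hw => ?_⟩
  · by_contra hc
    refine (hN w).2 ?_ hw
    -- If the series converged at `w + i h`, translating back by `-h` would give convergence at `w`.
    simpa using summable_shiftTerm_add hl hz ((hN _).1 hc) (-h)
  · refine hz.congr fun n => ?_
    rw [hDe, norm_smul, e.orthonormal.norm_eq_one, mul_one, Real.norm_eq_abs, sq_abs]
  · have hw' := (hN w).1 hw
    have haff : (fun h : H => shift Z T e l t (w + i h) z) =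
        fun h => shift Z T e l t w z + D h := funext fun h => shift_add hl hD hw' h
    rw [haff]
    exact ⟨fun h => summable_shiftTerm_add hl hz hw' h, contDiff_const.add D.contDiff,
      contDiff_const.add D.contDiff, fun h => D.hasFDerivAt.const_add _⟩

lemma ae_prod_summable_shiftTerm {mΩ : MeasurableSpace Ω} {P : Measure Ω} [SFinite P]
    [MeasurableSpace W] [BorelSpace W] {μ : Measure W} [SFinite μ]
    (hg : ∀ n, μ.map (l n) = gaussianReal 0 1)
    (hm : ∀ n, AEMeasurable (jumpCoeff Z T t n) P)
    (hz : ∀ᵐ z ∂P, Summable fun n => jumpCoeff Z T t n z ^ 2) :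
    ∀ᵐ x ∂(μ.prod P), Summable (shiftTerm Z T e l t x.1 x.2) := by
  -- The coefficients are only almost everywhere measurable; measurable versions make the
  -- convergence set measurable in the product, as Fubini requires.
  set f : ℕ → Ω → ℝ := fun n => (hm n).mk with hf
  have hfm : ∀ n, Measurable (f n) := fun n => (hm n).measurable_mk
  have hfe : ∀ᵐ z ∂P, ∀ n, jumpCoeff Z T t n z = f n z := ae_all_iff.2 fun n => (hm n).ae_eq_mk
  have hS : MeasurableSet
      {x : W × Ω | ∑' n, ENNReal.ofReal (f n x.2 ^ 2 * l n x.1 ^ 2) < ⊤} := by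
    refine measurableSet_lt (Measurable.tsum fun n => ENNReal.measurable_ofReal.comp ?_)
      measurable_const
    exact (((hfm n).comp measurable_snd).pow_const 2).mul
      (((l n).continuous.measurable.comp measurable_fst).pow_const 2)
  have hae : ∀ᵐ x ∂(μ.prod P), ∑' n, ENNReal.ofReal (f n x.2 ^ 2 * l n x.1 ^ 2) < ⊤ := by
    -- The order is exchanged so that `z` is frozen first and the coefficients become deterministic.
    rw [Measure.ae_prod_iff_ae_ae hS, Measure.ae_ae_comm hS]
    filter_upwards [hz, hfe] with z h1 h2
    simp only [h2] at h1
    filter_upwards [ae_summable_diagForm hg (fun n => sq_nonneg (f n z)) h1] with w hw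
    exact hw.tsum_ofReal_ne_top.lt_top
  filter_upwards [hae, Measure.quasiMeasurePreserving_snd.ae hfe] with x h1 h2
  rw [summable_shiftTerm_iff]
  refine (ENNReal.summable_toReal h1.ne).congr fun n => ?_
  rw [h2 n, ENNReal.toReal_ofReal (by positivity)]

lemma aestronglyMeasurable_shift {mΩ : MeasurableSpace Ω} {P : Measure Ω} [SFinite P]
    [MeasurableSpace W] [BorelSpace W] {μ : Measure W} [SFinite μ]
    (hm : ∀ n, AEMeasurable (jumpCoeff Z T t n) P)
    (hs : ∀ᵐ x ∂(μ.prod P), Summable (shiftTerm Z T e l t x.1 x.2)) :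
    AEStronglyMeasurable (fun x : W × Ω => shift Z T e l t x.1 x.2) (μ.prod P) := by
  refine aestronglyMeasurable_of_tendsto_ae atTop
    (f := fun N (x : W × Ω) => ∑ n ∈ Finset.range N, shiftTerm Z T e l t x.1 x.2 n)
    (fun N => Finset.aestronglyMeasurable_fun_sum _ fun n _ => ?_)
    (hs.mono fun x hx => hx.hasSum.tendsto_sum_nat)
  have h1 : AEMeasurable (fun x : W × Ω => jumpCoeff Z T t n x.2 * l n x.1) (μ.prod P) :=
    ((hm n).comp_quasiMeasurePreserving Measure.quasiMeasurePreserving_snd).mul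
      ((l n).continuous.measurable.comp measurable_fst).aemeasurable
  exact h1.aestronglyMeasurable.smul_const (e n)

end Perturbation

theorem theorem1
    {Ω : Type*} {mΩ : MeasurableSpace Ω} (P : Measure Ω) [IsProbabilityMeasure P]
    (𝓕 : Filtration ℝ≥0 mΩ) (h𝓕 : UsualConditions 𝓕 P)
    (Z : ℝ≥0 → Ω → ℝ) (hZ : IsSemimartingale 𝓕 P Z)
    (T : ℕ → Ω → WithTop ℝ≥0) (hT : AbsorbsJumps 𝓕 P Z T)
    {W : Type*} [AddCommGroup W] [Module ℝ W] [TopologicalSpace W] [IsTopologicalAddGroup W]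
    [ContinuousSMul ℝ W] [LocallyConvexSpace ℝ W] [PolishSpace W]
    [MeasurableSpace W] [BorelSpace W]
    {H : Type*} [NormedAddCommGroup H] [InnerProductSpace ℝ H] [CompleteSpace H]
    (i : H →L[ℝ] W) (μ : Measure W) [IsProbabilityMeasure μ] (hW : IsAbstractWienerSpace i μ)
    (e : HilbertBasis ℕ ℝ H) (l : ℕ → StrongDual ℝ W) (hl : ∀ n, IsDivergence i (l n) (e n))
    (t : ℝ≥0) :
    -- the series and the perturbation of identity are well defined almost surely
    ((∀ᵐ x ∂(μ.prod P), Summable (shiftTerm Z T e l t x.1 x.2)) ∧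
      AEStronglyMeasurable (fun x : W × Ω => shift Z T e l t x.1 x.2) (μ.prod P) ∧
      AEMeasurable (fun x : W × Ω => perturbedId i Z T e l t x.1 x.2) (μ.prod P)) ∧
    -- for almost every `z`, the partial map is smooth along `H` with a constant derivative
    (∀ᵐ z ∂P, ∃ (N : Set W) (D : H →L[ℝ] H),
      μ N = 0 ∧ HasZeroCapacity i μ e N ∧ IsHInvariant i N ∧
      (∀ n, D (e n) = jumpCoeff Z T t n z • e n) ∧
      Summable (fun n => ‖D (e n)‖ ^ 2) ∧
      ∀ w ∉ N,
        (∀ h : H, Summable (shiftTerm Z T e l t (w + i h) z)) ∧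
        ContDiff ℝ 1 (fun h : H => shift Z T e l t (w + i h) z) ∧
        ContDiff ℝ ∞ (fun h : H => shift Z T e l t (w + i h) z) ∧
        ∀ h : H, HasFDerivAt (fun k : H => shift Z T e l t (w + i k) z) D h) := by
  have hg : ∀ n, μ.map (l n) = gaussianReal 0 1 := fun n =>
    hW.map_divergence (hl n) (e.orthonormal.norm_eq_one n)
  have hm := fun n => hZ.aemeasurable_jumpCoeff hT t n
  have hz := hZ.summable_sq_jumpCoeff hT t
  have hs := ae_prod_summable_shiftTerm (e := e) hg hm hz
  have hsm := aestronglyMeasurable_shift hm hs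
  exact ⟨⟨hs, hsm, measurable_fst.aemeasurable.add
    (i.continuous.comp_aestronglyMeasurable hsm).aemeasurable⟩,
    hz.mono fun z hz => smooth_along_H hl hg hz⟩
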